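/- Let $\mathcal M$ be a model category, $K$ a set of cofibrant objects of $\mathcal M$, $T$ a monad on $\mathcal M$, and $U:\mathrm{Alg}(T;\mathcal M)\to\mathcal M$ the forgetful functor from the category of $T$-algebras, with left adjoint the free algebra functor $T$; put $T(K)=\{T(X): X\in K\}$. Definitions. Let $\mathcal D$ be a category with classes of weak equivalences, fibrations and cofibrations; a trivial (co)fibration is a (co)fibration that is a weak equivalence. $\mathcal D$ is a *semi-model category* if: it is bicomplete; weak equivalences satisfy 2-out-of-3 and all three classes are closed under retracts; cofibrations have the left lifting property against trivial fibrations, and trivial cofibrations with cofibrant domain have it against fibrations; every map factors functorially as a cofibration followed by a trivial fibration, and every map with cofibrant domain factors functorially as a trivial cofibration followed by a fibration; fibrations and trivial fibrations are closed under pullback. $\mathcal D$ is a *semi-model category over* a model category $\mathcal N$, with respect to a functor $V:\mathcal D\to\mathcal N$, if the same axioms hold with "$A$ cofibrant in $\mathcal D$" replaced by "$V(A)$ cofibrant in $\mathcal N$" in the conditions on the domain $A$, $V$ preserves and reflects fibrations and trivial fibrations, and $V(\emptyset)$ is cofibrant in $\mathcal N$, where $\emptyset$ is the initial object. $T$-algebras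 are *admissible* (resp. *semi-admissible*) over a model structure on $\mathcal M$ if $\mathrm{Alg}(T;\mathcal M)$ has a model (resp. semi-model) structure in which $f$ is a weak equivalence or a fibration if and only if $Uf$ is one. A map $f:A\to B$ of $\mathcal D$ is an *$L$-colocal equivalence*, for a set $L$ of cofibrant objects of $\mathcal D$, if for all $X\in L$ the map $\mathrm{map}_{\mathcal D}(X,A)\to\mathrm{map}_{\mathcal D}(X,B)$ of right homotopy function complexes is a weak equivalence of simplicial sets. This map is computed as $\mathcal D(X,A_\bullet)\to\mathcal D(X,B_\bullet)$ for a simplicial resolution $A_\bullet\to B_\bullet$ (a Reedy fibrant approximation of constant simplicial objects) of $f$ or of a map weakly equivalent to $f$ by maps $A'\to A$, $B'\to B$. $R_L\mathcal D$ denotes the category $\mathcal D$ with the $L$-colocal equivalences as weak equivalences, the same fibrations, and as cofibrations the maps with the left lifting property against those maps that are both. The right Bousfield localization $R_L\mathcal D$ exists, as a model category, as a semi-model category, or as a semi-model category over $\mathcal N$, if these three classes satisfy the respective axioms. Theorem. Suppose that $R_K\mathcal M$ exists as a model category. (a) Suppose that $T$-algebras are admissible over $\mathcal M$. Then $T$-algebras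 are admissible over $R_K\mathcal M$ if and only if the right Bousfield localization $R_{T(K)}\mathrm{Alg}(T;\mathcal M)$ exists as a model category. If either holds, the model categories $\mathrm{Alg}(T;R_K\mathcal M)$ and $R_{T(K)}\mathrm{Alg}(T;\mathcal M)$ are equal. (b) Suppose that $T$-algebras are semi-admissible over $\mathcal M$. Then $T$-algebras are semi-admissible over $R_K\mathcal M$ if and only if $R_{T(K)}\mathrm{Alg}(T;\mathcal M)$ exists as a semi-model category. If either holds, the semi-model categories $\mathrm{Alg}(T;R_K\mathcal M)$ and $R_{T(K)}\mathrm{Alg}(T;\mathcal M)$ are equal. Both assertions also hold when "semi-model category" is replaced throughout these two sentences by "semi-model category over $R_K\mathcal M$ with respect to $U$". -/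

import Mathlib

open CategoryTheory Limits Opposite HomotopicalAlgebra

universe v u u'

namespace RightLoc

/-! ### Weak equivalences of simplicial sets -/

/-- The equivalence relation on maps of simplicial sets generated by simplicial homotopy. -/
def SHomotopic {X Z : SSet.{v}} (f g : X ⟶ Z) : Prop :=
  Relation.EqvGen (fun a b : X ⟶ Z => Nonempty (SSet.Homotopy a b)) f g

/-- A map `f : X ⟶ Y` of simplicial sets is a (Kan-Quillen) weak equivalence if, for every Kan
complex `Z`, precomposition with `f` is a bijection `[Y, Z] → [X, Z]` on simplicial homotopy
classes of maps. -/
def IsSSetWeakEquivalence {X Y : SSet.{v}} (f : X ⟶ Y) : Prop :=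
  ∀ Z : SSet.{v}, SSet.KanComplex Z →
    (∀ g : X ⟶ Z, ∃ h : Y ⟶ Z, SHomotopic (f ≫ h) g) ∧
    (∀ h h' : Y ⟶ Z, SHomotopic (f ≫ h) (f ≫ h') → SHomotopic h h')

/-! ### Three distinguished classes of maps -/

/-- Three distinguished classes of maps on a category, with no axioms. -/
@[ext]
structure ModelClasses (D : Type u) [Category.{v} D] where
  /-- weak equivalences -/
  W : MorphismProperty D
  /-- fibrations -/
  Fib : MorphismProperty D
  /-- cofibrations -/
  Cof : MorphismProperty D

namespace ModelClasses

/-- The three classes of a model category. -/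
def ofModelCategory (D : Type u) [Category.{v} D] [ModelCategory D] : ModelClasses D where
  W := weakEquivalences D
  Fib := fibrations D
  Cof := cofibrations D

variable {D : Type u} [Category.{v} D] (S : ModelClasses D)

/-- Trivial fibrations. -/
def TrivFib : MorphismProperty D := S.Fib ⊓ S.W

/-- Trivial cofibrations. -/
def TrivCof : MorphismProperty D := S.Cof ⊓ S.W

/-- The cofibrant objects: the map from the initial object is a cofibration. -/
def Cofibrant : ObjectProperty D := fun X => ∃ (I : D) (hI : IsInitial I), S.Cof (hI.to X)

/-- The three classes satisfy the axioms of a model category. -/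
def IsModel : Prop := ∃ h : ModelCategory D, @ofModelCategory D _ h = S

/-! ### Semi-model categories -/

end ModelClasses

/-- A functorial factorization, as a map in `L` followed by a map in `R`, of all the maps
satisfying `P`. -/
structure FunctorialFactorizationOn {D : Type u} [Category.{v} D] (P : ObjectProperty (Arrow D))
    (L R : MorphismProperty D) where
  /-- the middle object -/
  Z : P.FullSubcategory ⥤ D
  /-- the first map -/
  i : P.ι ⋙ Arrow.leftFunc ⟶ Z
  /-- the second map -/
  p : Z ⟶ P.ι ⋙ Arrow.rightFunc
  fac (f : P.FullSubcategory) : i.app f ≫ p.app f = f.obj.hom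
  hi (f : P.FullSubcategory) : L (i.app f)
  hp (f : P.FullSubcategory) : R (p.app f)

namespace ModelClasses

variable {D : Type u} [Category.{v} D]

/-- The axioms of a semi-model category, in which lifting and factorization for trivial
cofibrations and fibrations are required for maps with domain in `dom` only. -/
structure SemiModelAxioms (S : ModelClasses D) (dom : ObjectProperty D) : Prop where
  hasLimits : HasLimits D
  hasColimits : HasColimits D
  two_out_of_three : S.W.HasTwoOutOfThreeProperty
  retract_W : S.W.IsStableUnderRetracts
  retract_Fib : S.Fib.IsStableUnderRetracts
  retract_Cof : S.Cof.IsStableUnderRetracts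
  lift_cof_trivFib {A B X Y : D} (i : A ⟶ B) (p : X ⟶ Y) :
    S.Cof i → S.TrivFib p → HasLiftingProperty i p
  lift_trivCof_fib {A B X Y : D} (i : A ⟶ B) (p : X ⟶ Y) :
    dom A → S.TrivCof i → S.Fib p → HasLiftingProperty i p
  factor_cof_trivFib : MorphismProperty.HasFunctorialFactorization S.Cof S.TrivFib
  factor_trivCof_fib :
    Nonempty (FunctorialFactorizationOn (fun f : Arrow D => dom f.left) S.TrivCof S.Fib)
  pullback_fib : S.Fib.IsStableUnderBaseChange
  pullback_trivFib : S.TrivFib.IsStableUnderBaseChange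

/-- A semi-model category: the axioms on trivial cofibrations are required for maps with
cofibrant domain. -/
def IsSemiModel (S : ModelClasses D) : Prop := S.SemiModelAxioms S.Cofibrant

/-- A semi-model category over a base: here the axioms on trivial cofibrations concern the maps
whose domain becomes cofibrant in the base `(M, N)` after applying `U : D ⥤ M`.
Conditions on `(M, N)` and `U` alone (cofibrant generation of the base, preservation of ordinal
colimits by `U`) are not part of this predicate. -/
structure IsSemiModelOver (S : ModelClasses D) {M : Type u'} [Category.{v} M]
    (N : ModelClasses M) (U : D ⥤ M) : Prop extends
    S.SemiModelAxioms (fun A => N.Cofibrant (U.obj A)) where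
  fib_iff {A B : D} (f : A ⟶ B) : S.Fib f ↔ N.Fib (U.map f)
  trivFib_iff {A B : D} (f : A ⟶ B) : S.TrivFib f ↔ N.TrivFib (U.map f)
  initial_cofibrant {I : D} (hI : IsInitial I) : N.Cofibrant (U.obj I)

end ModelClasses

/-! ### Simplicial resolutions and homotopy function complexes -/

section Reedy

variable {D : Type u} [Category.{v} D]

/-- The proper faces of the standard `n`-simplex: the non-invertible injections into `[n]`. -/
def properFaces (n : ℕ) : ObjectProperty (Over (SimplexCategory.mk n)) :=
  fun f => Mono f.hom ∧ ¬ IsIso f.hom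

/-- The diagram of the `X_k` over the proper faces `[k] ↪ [n]`; its limit is the `n`-th matching
object of `X`. -/
def matchingDiagram (X : SimplicialObject D) (n : ℕ) :
    (properFaces n).FullSubcategoryᵒᵖ ⥤ D :=
  ((properFaces n).ι ⋙ Over.forget _).op ⋙ X

/-- The cone with apex `X_n` given by the face maps. -/
def matchingCone (X : SimplicialObject D) (n : ℕ) : Cone (matchingDiagram X n) where
  pt := X.obj (op (SimplexCategory.mk n))
  π :=
    { app := fun f => X.map f.unop.obj.hom.op
      naturality := fun f g a => by
        have h : a.unop.hom.left ≫ f.unop.obj.hom = g.unop.obj.hom := Over.w a.unop.hom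
        change 𝟙 _ ≫ X.map g.unop.obj.hom.op = X.map f.unop.obj.hom.op ≫ X.map a.unop.hom.left.op
        rw [Category.id_comp, ← X.map_comp, ← op_comp, h] }

namespace ModelClasses

variable (S : ModelClasses D)

/-- `X` is Reedy fibrant: each map from `X_n` to the `n`-th matching object is a fibration. -/
def ReedyFibrant (X : SimplicialObject D) : Prop :=
  ∀ n : ℕ, ∃ (c : Cone (matchingDiagram X n)) (hc : IsLimit c),
    S.Fib (hc.lift (matchingCone X n))

/-- `j` exhibits `X` as a simplicial resolution of `A`: a Reedy fibrant approximation of the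
constant simplicial object on `A`. -/
structure IsSimplicialResolution {A : D} {X : SimplicialObject D}
    (j : (SimplicialObject.const D).obj A ⟶ X) : Prop where
  reedyFibrant : S.ReedyFibrant X
  weq (n : SimplexCategoryᵒᵖ) : S.W (j.app n)

/-- A simplicial resolution of a map `f : A ⟶ B`. In a model category one can take
`A' = A` and `B' = B`, with identities as `a` and `b`; in a semi-model category an object need
not have a fibrant approximation before it is replaced by a weakly equivalent one, for instance
by a cofibrant approximation. -/
structure MapResolution {A B : D} (f : A ⟶ B) where
  /-- an object weakly equivalent to `A` -/
  A' : D
  /-- an object weakly equivalent to `B` -/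
  B' : D
  /-- the approximation of `A` -/
  a : A' ⟶ A
  /-- the approximation of `B` -/
  b : B' ⟶ B
  weq_a : S.W a
  weq_b : S.W b
  /-- the approximation of `f` -/
  f' : A' ⟶ B'
  comm : a ≫ f = f' ≫ b
  /-- the resolution of the source -/
  resA : SimplicialObject D
  /-- the resolution of the target -/
  resB : SimplicialObject D
  /-- the coaugmentation of the source -/
  jA : (SimplicialObject.const D).obj A' ⟶ resA
  /-- the coaugmentation of the target -/
  jB : (SimplicialObject.const D).obj B' ⟶ resB
  isRes_A : S.IsSimplicialResolution jA
  isRes_B : S.IsSimplicialResolution jB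
  /-- the resolution of `f` -/
  φ : resA ⟶ resB
  comm_res : jA ≫ φ = (SimplicialObject.const D).map f' ≫ jB

end ModelClasses

/-- The map of simplicial sets `D(X, A_•) ⟶ D(X, B_•)` induced by `φ : A_• ⟶ B_•`. -/
def homMap (X : D) {A B : SimplicialObject D} (φ : A ⟶ B) :
    (((SimplicialObject.whiskering D (Type v)).obj (coyoneda.obj (op X))).obj A : SSet.{v}) ⟶
      ((SimplicialObject.whiskering D (Type v)).obj (coyoneda.obj (op X))).obj B :=
  ((SimplicialObject.whiskering D (Type v)).obj (coyoneda.obj (op X))).map φ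

/-! ### Right Bousfield localization -/

namespace ModelClasses

variable (S : ModelClasses D)

/-- `K`-colocal equivalences, for a set `K` of cofibrant objects: for all `X ∈ K`, the map
induced by `f` on right homotopy function complexes out of `X` is a weak equivalence. As `X` is
cofibrant, no cofibrant approximation of `X` is needed. -/
def ColocalEquivalence (K : Set D) : MorphismProperty D := fun _ _ f =>
  ∀ X ∈ K, ∃ r : S.MapResolution f, IsSSetWeakEquivalence (homMap X r.φ)

/-- The three classes of the right Bousfield localization: the weak equivalences are the
`K`-colocal equivalences, the fibrations are unchanged, and the cofibrations are the maps with the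
left lifting property against the maps that are both. The localization exists, as a model or
semi-model category, if these classes satisfy the respective axioms. -/
def rightBousfield (K : Set D) : ModelClasses D where
  W := S.ColocalEquivalence K
  Fib := S.Fib
  Cof := (S.Fib ⊓ S.ColocalEquivalence K).llp

end ModelClasses

end Reedy

/-! ### Algebras over a monad -/

section Algebras

variable {M : Type u} [Category.{v} M] {T : Monad M}

/-- Weak equivalences and fibrations of `T`-algebras are created by the forgetful functor from
the classes `N` on `M`. -/
structure IsTransferred (N : ModelClasses M) (S : ModelClasses T.Algebra) : Prop where
  weq_iff {A B : T.Algebra} (f : A ⟶ B) : S.W f ↔ N.W (T.forget.map f)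
  fib_iff {A B : T.Algebra} (f : A ⟶ B) : S.Fib f ↔ N.Fib (T.forget.map f)

/-- `S` is a transferred model structure: it witnesses that `T`-algebras are admissible
over `(M, N)`. -/
def IsAdmissibleStructure (N : ModelClasses M) (S : ModelClasses T.Algebra) : Prop :=
  IsTransferred N S ∧ S.IsModel

/-- `S` is a transferred semi-model structure: it witnesses that `T`-algebras are semi-admissible
over `(M, N)`. -/
def IsSemiAdmissibleStructure (N : ModelClasses M) (S : ModelClasses T.Algebra) : Prop :=
  IsTransferred N S ∧ S.IsSemiModel

/-- The variant of semi-admissibility in which cofibrancy of domains is tested in the base. -/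
def IsSemiAdmissibleOverStructure (N : ModelClasses M) (S : ModelClasses T.Algebra) : Prop :=
  IsTransferred N S ∧ S.IsSemiModelOver N T.forget

end Algebras

end RightLoc

/-! Everything reduces to one statement: a map f of algebras is a T(K)-colocal equivalence exactly
when Uf is a K-colocal equivalence (`colocalEquivalence_iff`). Granting it, a structure transferred
from R_K M and the localization R_{T(K)}Alg have the same weak equivalences and the same fibrations.
In each kind of structure considered the cofibrations are the maps lifting against trivial
fibrations, so the two triples coincide, and one satisfies the axioms if and only if the other does
(`exists_transferred_iff`).

The functor U preserves limits and creates fibrations and weak equivalences, so it sends a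
simplicial resolution of f to one of Uf, and the adjunction identifies Alg(TX, A_•) with M(X, UA_•).
This gives one direction. Conversely, colocality of Uf only supplies some resolution, which need not
come from algebras. Take then any resolution of f. Its image is Reedy fibrant in R_K M, whose
fibrations are those of M, and is levelwise a K-colocal equivalence by 2-out-of-3. A Ken Brown
argument applied in R_K M (`isSSetWeakEquivalence_homMap`) shows that it induces a weak equivalence
on maps out of any object cofibrant in R_K M.

Two inputs remain. Objects of K are cofibrant in R_K M (`llp_initial_of_resolutions`,
`cofibrant_rightBousfield`). Resolutions of maps of algebras exist, by Reedy factorization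
(`exists_reedy_factorization`), applied in the semi-model case after cofibrant replacement. -/

namespace RightLoc

open Simplicial

/-! ### Weak equivalences of simplicial sets: trivial fibrations, and surjectivity on π₀ -/

section SimplicialSets

open MonoidalCategory

variable {X Y Z E F : SSet.{v}}

/-- Constructor for homotopies of maps of simplicial sets. -/
def homotopyMk {f g : X ⟶ Y} (h : X ⊗ Δ[1] ⟶ Y) (h₀ : SSet.ι₀ ≫ h = f) (h₁ : SSet.ι₁ ≫ h = g) :
    SSet.Homotopy f g where
  h := h
  h₀ := h₀
  h₁ := h₁
  -- The homotopy is relative to the empty subcomplex, so this condition is vacuous.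
  rel := by
    ext n ⟨⟨_, hx⟩, _⟩
    exact hx.elim

namespace SHomotopic

lemma refl (f : X ⟶ Y) : SHomotopic f f := Relation.EqvGen.refl _

lemma symm {f g : X ⟶ Y} (h : SHomotopic f g) : SHomotopic g f := Relation.EqvGen.symm _ _ h

lemma trans {f g k : X ⟶ Y} (h : SHomotopic f g) (h' : SHomotopic g k) : SHomotopic f k :=
  Relation.EqvGen.trans _ _ _ h h'

lemma map_of_homotopy {X' Y' : SSet.{v}} (Φ : (X ⟶ Y) → (X' ⟶ Y'))
    (hΦ : ∀ a b : X ⟶ Y, SSet.Homotopy a b → SHomotopic (Φ a) (Φ b))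
    {f g : X ⟶ Y} (h : SHomotopic f g) : SHomotopic (Φ f) (Φ g) := by
  induction h with
  | rel a b h => exact hΦ _ _ h.some
  | refl a => exact refl _
  | symm a b _ ih => exact ih.symm
  | trans a b c _ _ ih₁ ih₂ => exact ih₁.trans ih₂

lemma postcomp {f g : X ⟶ Y} (h : SHomotopic f g) (k : Y ⟶ Z) : SHomotopic (f ≫ k) (g ≫ k) :=
  h.map_of_homotopy (fun a => a ≫ k) fun _ _ H => Relation.EqvGen.rel _ _
    ⟨homotopyMk (H.h ≫ k) (by rw [SSet.Homotopy.h₀_assoc]) (by rw [SSet.Homotopy.h₁_assoc])⟩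

lemma precomp {f g : Y ⟶ Z} (h : SHomotopic f g) (k : X ⟶ Y) : SHomotopic (k ≫ f) (k ≫ g) :=
  h.map_of_homotopy (fun a => k ≫ a) fun _ _ H => Relation.EqvGen.rel _ _
    ⟨homotopyMk (k ▷ _ ≫ H.h) (by rw [← Category.assoc, SSet.ι₀_comp, Category.assoc, H.h₀])
      (by rw [← Category.assoc, SSet.ι₁_comp, Category.assoc, H.h₁])⟩

end SHomotopic

namespace IsSSetWeakEquivalence

/-- Homotopy equivalences are weak equivalences. -/
lemma of_homotopyInverse (f : X ⟶ Y) (g : Y ⟶ X) (hfg : SHomotopic (f ≫ g) (𝟙 X))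
    (hgf : SHomotopic (g ≫ f) (𝟙 Y)) : IsSSetWeakEquivalence f := by
  intro Z _
  refine ⟨fun k => ⟨g ≫ k, by simpa using hfg.postcomp k⟩, fun h h' H => ?_⟩
  have h₁ : SHomotopic h (g ≫ f ≫ h) := by simpa using (hgf.postcomp h).symm
  have h₂ : SHomotopic (g ≫ f ≫ h') h' := by simpa using hgf.postcomp h'
  exact h₁.trans ((H.precomp g).trans h₂)

lemma of_iso (e : X ≅ Y) : IsSSetWeakEquivalence e.hom :=
  of_homotopyInverse _ e.inv (by simpa using SHomotopic.refl _) (by simpa using SHomotopic.refl _)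

lemma comp {f : X ⟶ Y} {g : Y ⟶ Z} (hf : IsSSetWeakEquivalence f) (hg : IsSSetWeakEquivalence g) :
    IsSSetWeakEquivalence (f ≫ g) := by
  intro W hW
  refine ⟨fun k => ?_, fun h h' H => ?_⟩
  · obtain ⟨l, hl⟩ := (hf W hW).1 k
    obtain ⟨m, hm⟩ := (hg W hW).1 l
    exact ⟨m, by simpa using (hm.precomp f).trans hl⟩
  · exact (hg W hW).2 _ _ ((hf W hW).2 _ _ (by simpa using H))

/-- A section of a weak equivalence is a weak equivalence. -/
lemma of_section {f : X ⟶ Y} {g : Y ⟶ X} (hf : IsSSetWeakEquivalence f) (h : g ≫ f = 𝟙 Y) :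
    IsSSetWeakEquivalence g := by
  intro W hW
  refine ⟨fun k => ⟨f ≫ k, by rw [reassoc_of% h]; exact SHomotopic.refl _⟩, fun a b H => ?_⟩
  obtain ⟨a', ha'⟩ := (hf W hW).1 a
  obtain ⟨b', hb'⟩ := (hf W hW).1 b
  have h₁ : SHomotopic a' (g ≫ a) := by simpa [reassoc_of% h] using ha'.precomp g
  have h₂ : SHomotopic b' (g ≫ b) := by simpa [reassoc_of% h] using hb'.precomp g
  have h₃ : SHomotopic a' b' := h₁.trans (H.trans h₂.symm)
  exact ha'.symm.trans ((h₃.precomp f).trans hb')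

lemma of_arrow_iso {X' Y' : SSet.{v}} {f : X ⟶ Y} {f' : X' ⟶ Y'} (e : Arrow.mk f ≅ Arrow.mk f')
    (hf : IsSSetWeakEquivalence f) : IsSSetWeakEquivalence f' := by
  have h : f' = (Arrow.leftFunc.mapIso e).inv ≫ f ≫ (Arrow.rightFunc.mapIso e).hom := by
    have h₁ : f ≫ e.hom.right = e.hom.left ≫ f' := (Arrow.w e.hom).symm
    have h₂ : e.inv.left ≫ e.hom.left = 𝟙 _ := by rw [← Arrow.comp_left, e.inv_hom_id]; rfl
    change f' = e.inv.left ≫ f ≫ e.hom.right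
    rw [h₁, reassoc_of% h₂]
  rw [h]
  exact (of_iso (Arrow.leftFunc.mapIso e).symm).comp (hf.comp (of_iso _))

end IsSSetWeakEquivalence

/-- The disjoint union of two copies of a simplicial set. -/
def twoCopies (E : SSet.{v}) : SSet.{v} where
  obj n := E.obj n ⊕ E.obj n
  map α := ↾(Sum.map (E.map α) (E.map α))
  map_id n := by ext (x | x) <;> simp
  map_comp α β := by ext (x | x) <;> simp

/-- The map out of two copies of a simplicial set given by two maps. -/
def twoCopiesDesc (f g : E ⟶ F) : twoCopies E ⟶ F where
  app n := ↾(Sum.elim (f.app n) (g.app n))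
  naturality n m α := by
    ext (x | x)
    · exact ConcreteCategory.congr_hom (f.naturality α) x
    · exact ConcreteCategory.congr_hom (g.naturality α) x

lemma twoCopiesDesc_comp (f g : E ⟶ F) (k : F ⟶ Z) :
    twoCopiesDesc f g ≫ k = twoCopiesDesc (f ≫ k) (g ≫ k) := by
  ext n (x | x) <;> rfl

lemma twoCopiesDesc_inj {f g f' g' : E ⟶ F} (h : twoCopiesDesc f g = twoCopiesDesc f' g') :
    f = f' ∧ g = g' := by
  have h' (n) (x : E.obj n ⊕ E.obj n) :
      Sum.elim (f.app n) (g.app n) x = Sum.elim (f'.app n) (g'.app n) x :=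
    ConcreteCategory.congr_hom (C := Type v) (NatTrans.congr_app h n) x
  constructor <;> ext n x
  · exact h' _ (Sum.inl x)
  · exact h' _ (Sum.inr x)

instance : Mono (twoCopiesDesc (SSet.ι₀ (X := E)) SSet.ι₁) := by
  have (n : SimplexCategoryᵒᵖ) : Mono ((twoCopiesDesc (SSet.ι₀ (X := E)) SSet.ι₁).app n) := by
    rw [mono_iff_injective]
    have h₀₁ (x y : E.obj n) : ¬ (SSet.ι₀.app n x = SSet.ι₁.app n y) := fun h => by
      have h₁ := congrArg (fun z => SSet.stdSimplex.objEquiv z.2) h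
      have h₂ := congrArg (fun z => z.toOrderHom 0) h₁
      exact zero_ne_one h₂
    rintro (x | x) (y | y) h
    · exact congrArg Sum.inl (congrArg Prod.fst h)
    · exact (h₀₁ _ _ h).elim
    · exact (h₀₁ _ _ h.symm).elim
    · exact congrArg Sum.inr (congrArg Prod.fst h)
  exact NatTrans.mono_of_mono_app _

/-- A map of simplicial sets with the right lifting property against boundary inclusions is a
weak equivalence. -/
lemma isSSetWeakEquivalence_of_rlp (p : E ⟶ F)
    (hp : ∀ n : ℕ, HasLiftingProperty (SSet.boundary.{v} n).ι p) : IsSSetWeakEquivalence p := by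
  have hp' : (MorphismProperty.monomorphisms SSet.{v}).rlp p := by
    rw [SSet.rlp_monomorphisms]
    rintro _ _ _ ⟨n⟩
    exact hp n
  have lift₁ : HasLiftingProperty (SSet.Subcomplex.ι (⊥ : F.Subcomplex)) p :=
    hp' _ (MorphismProperty.monomorphisms.infer_property _)
  have lift₂ : HasLiftingProperty (twoCopiesDesc (SSet.ι₀ (X := E)) SSet.ι₁) p :=
    hp' _ (MorphismProperty.monomorphisms.infer_property _)
  -- Lifting along ∅ ⊆ F gives a section `s` of `p`; lifting along the two ends of the cylinder on E
  -- gives a homotopy from `p ≫ s` to the identity.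
  let sq : CommSq (SSet.Subcomplex.isInitialBot.to E) (SSet.Subcomplex.ι (⊥ : F.Subcomplex)) p
    (𝟙 F) := ⟨SSet.Subcomplex.isInitialBot.hom_ext _ _⟩
  let s : F ⟶ E := sq.lift
  have hs : s ≫ p = 𝟙 F := sq.fac_right
  let sq' : CommSq (twoCopiesDesc (p ≫ s) (𝟙 E)) (twoCopiesDesc (SSet.ι₀ (X := E)) SSet.ι₁) p
      (CartesianMonoidalCategory.fst _ _ ≫ p) := ⟨by
    rw [twoCopiesDesc_comp, twoCopiesDesc_comp]
    simp [hs]⟩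
  have h := sq'.fac_left
  rw [twoCopiesDesc_comp] at h
  obtain ⟨h₀, h₁⟩ := twoCopiesDesc_inj h
  exact .of_homotopyInverse p s (Relation.EqvGen.rel _ _ ⟨homotopyMk _ h₀ h₁⟩)
    (by rw [hs]; exact SHomotopic.refl _)

/-- The constant simplicial set on a type. -/
abbrev discreteSSet (S : Type v) : SSet.{v} := (SimplicialObject.const (Type v)).obj S

lemma app_map_discrete {S : Type v} (g : X ⟶ discreteSSet S) {m n : SimplexCategoryᵒᵖ}
    (α : m ⟶ n) (x : X.obj m) : g.app n (X.map α x) = g.app m x :=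
  ConcreteCategory.congr_hom (C := Type v) (g.naturality α) x

/-- Every simplex of Δ[n] is a restriction of the top one, and restriction does nothing in a
discrete simplicial set. -/
lemma app_eq_of_stdSimplex_discrete {S : Type v} {n : ℕ} (g : Δ[n] ⟶ discreteSSet S)
    {m k : SimplexCategoryᵒᵖ} (x : Δ[n].obj m) (y : Δ[n].obj k) :
    (g.app m x : S) = g.app k y := by
  have h {m : SimplexCategoryᵒᵖ} (x : Δ[n].obj m) :
      (g.app m x : S) = g.app (op ⦋n⦌) (SSet.stdSimplex.objEquiv.symm (𝟙 _)) := by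
    rw [← app_map_discrete g (SSet.stdSimplex.objEquiv x).op]
    refine congrArg (g.app m) ?_
    apply SSet.stdSimplex.objEquiv.injective
    exact (Category.comp_id _).symm
  rw [h x, h y]

/-- Each face of the horn contains the vertex `i`, so all faces take the value at that vertex, and
the constant map with this value is a filler. -/
lemma kanComplex_discreteSSet (S : Type v) : SSet.KanComplex (discreteSSet S) := by
  rw [SSet.KanComplex.iff]
  intro n i f hf
  obtain ⟨t, ht⟩ := hf.exists_desc
  obtain ⟨j₀, hj₀⟩ := exists_ne i
  have hmem : SSet.stdSimplex.obj₀Equiv.symm i ∈ (SSet.horn.{v} (n + 1) i).obj (op ⦋0⦌) := by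
    rw [SSet.mem_horn_iff_notMem_range]
    refine ⟨j₀, hj₀, ?_⟩
    rintro ⟨l, hl⟩
    exact hj₀ hl.symm
  refine ⟨⟨fun _ => ↾(fun _ => (t.app (op ⦋0⦌) ⟨_, hmem⟩ : S)), fun _ _ _ => rfl⟩,
    fun j hj => ?_⟩
  obtain ⟨k, hk⟩ := Fin.exists_succAbove_eq (Ne.symm hj)
  have key : (f j hj).app (op ⦋0⦌) (SSet.stdSimplex.obj₀Equiv.symm k) =
      t.app (op ⦋0⦌) ⟨_, hmem⟩ := by
    rw [← ht j hj]
    refine congrArg (t.app (op ⦋0⦌)) (Subtype.ext ?_)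
    have h₁ : ((SSet.horn.ι i j hj).app (op ⦋0⦌) (SSet.stdSimplex.obj₀Equiv.symm k)).1 =
        (SSet.stdSimplex.δ j).app (op ⦋0⦌) (SSet.stdSimplex.obj₀Equiv.symm k) :=
      ConcreteCategory.congr_hom (C := Type v)
        (NatTrans.congr_app (SSet.horn.ι_ι i j hj) (op ⦋0⦌)) _
    refine h₁.trans (SSet.stdSimplex.objEquiv.injective ?_)
    ext l
    exact congrArg Fin.val hk
  ext m x
  exact key.symm.trans (app_eq_of_stdSimplex_discrete _ _ _)

/-- A homotopy into a discrete target is constant on vertices, and maps into such a target are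
determined by their vertices. -/
lemma SHomotopic.eq_of_discrete {S : Type v} {f g : X ⟶ discreteSSet S} (h : SHomotopic f g) :
    f = g := by
  induction h with
  | rel a b h =>
    obtain ⟨H⟩ := h
    have h₀ := H.toSimplicialObjectHomotopy.h_zero_comp_δ_zero 0
    have h₁ := H.toSimplicialObjectHomotopy.h_last_comp_δ_last 0
    have h₂ : a.app (op ⦋0⦌) = b.app (op ⦋0⦌) := h₁.symm.trans h₀
    ext n x
    let α : n ⟶ op ⦋0⦌ := (SimplexCategory.const ⦋0⦌ n.unop 0).op
    exact (app_map_discrete a α x).symm.trans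
      ((ConcreteCategory.congr_hom (C := Type v) h₂ _).trans (app_map_discrete b α x))
  | refl a => rfl
  | symm a b _ ih => exact ih.symm
  | trans a b c _ _ ih₁ ih₂ => exact ih₁.trans ih₂

/-- The edge of `x` from vertex 0 to vertex `i` joins the two components. This makes `toDiscrete`
compatible with all operators. -/
lemma π₀_mk_map_const {n : ℕ} (x : X _⦋n⦌) (i : Fin (n + 1)) :
    SSet.π₀.mk (X.map (SimplexCategory.const ⦋0⦌ ⦋n⦌ 0).op x) =
      SSet.π₀.mk (X.map (SimplexCategory.const ⦋0⦌ ⦋n⦌ i).op x) :=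
  SSet.π₀.sound (SSet.Edge.mk (X.map (SimplexCategory.mkOfLe 0 i (Fin.zero_le i)).op x)
    (by
      change (X.map _ ≫ X.map _) x = _
      rw [← X.map_comp, ← op_comp]
      refine congrArg (fun a => X.map (Quiver.Hom.op a) x) ?_
      ext l
      fin_cases l
      rfl)
    (by
      change (X.map _ ≫ X.map _) x = _
      rw [← X.map_comp, ← op_comp]
      refine congrArg (fun a => X.map (Quiver.Hom.op a) x) ?_
      ext l
      fin_cases l
      rfl))

/-- The map to a discrete simplicial set given by a function on connected components. -/
def toDiscrete {S : Type v} (c : SSet.π₀ X → S) : X ⟶ discreteSSet S where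
  app n := ↾(fun x => c (SSet.π₀.mk (X.map (SimplexCategory.const ⦋0⦌ n.unop 0).op x)))
  naturality n m α := by
    ext x
    change c _ = c _
    rw [π₀_mk_map_const (n := n.unop.len) x (α.unop.toOrderHom 0)]
    refine congrArg (fun z => c (SSet.π₀.mk z)) ?_
    change (X.map _ ≫ X.map _) x = _
    rw [← X.map_comp]
    rfl

lemma toDiscrete_app_zero {S : Type v} (c : SSet.π₀ X → S) (x : X _⦋0⦌) :
    (toDiscrete c).app _ x = c (SSet.π₀.mk x) := by
  change c (SSet.π₀.mk (X.map (SimplexCategory.const ⦋0⦌ ⦋0⦌ 0).op x)) = _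
  simp

/-- The indicator of the image of π₀ and the constant `True` are two maps from Y to a discrete Kan
complex that agree after `f`; they are therefore homotopic, hence equal. -/
lemma IsSSetWeakEquivalence.mapπ₀_surjective {f : X ⟶ Y} (hf : IsSSetWeakEquivalence f) :
    Function.Surjective (SSet.mapπ₀ f) := by
  let S := ULift.{v} Prop
  have key : toDiscrete (S := S) (fun y => ⟨y ∈ Set.range (SSet.mapπ₀ f)⟩) =
      toDiscrete (S := S) (fun _ => ⟨True⟩) := by
    refine ((hf _ (kanComplex_discreteSSet S)).2 _ _ ?_).eq_of_discrete
    have h : f ≫ toDiscrete (S := S) (fun y => ⟨y ∈ Set.range (SSet.mapπ₀ f)⟩) =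
        f ≫ toDiscrete (S := S) (fun _ => ⟨True⟩) := by
      refine NatTrans.ext (funext fun n => ?_)
      refine ConcreteCategory.hom_ext (C := Type v) _ _ fun x => ?_
      refine ULift.ext _ _ (propext ⟨fun _ => trivial, fun _ => ?_⟩)
      exact ⟨SSet.π₀.mk (X.map (SimplexCategory.const ⦋0⦌ n.unop 0).op x), congrArg SSet.π₀.mk
        (ConcreteCategory.congr_hom (C := Type v) (f.naturality _) x)⟩
    rw [h]
    exact SHomotopic.refl _
  intro y
  obtain ⟨y, rfl⟩ := y.mk_surjective
  have h := ConcreteCategory.congr_hom (C := Type v) (NatTrans.congr_app key (op ⦋0⦌)) y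
  rw [toDiscrete_app_zero, toDiscrete_app_zero] at h
  exact (congrArg ULift.down h).mpr trivial

end SimplicialSets

/-! ### Matching objects and relative matching maps -/

section Matching

/-- Finiteness of the indexing category is what lets matching objects exist with finite limits only.
-/
instance (n : ℕ) : Finite (properFaces n).FullSubcategory := by
  let S := Σ k : Fin (n + 1),
    {f : SimplexCategory.mk k ⟶ SimplexCategory.mk n // Mono f ∧ ¬ IsIso f}
  let F : S → (properFaces n).FullSubcategory := fun s => ⟨Over.mk s.2.1, s.2.2⟩
  refine Finite.of_surjective F fun x => ?_
  have : Mono x.obj.hom := x.property.1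
  have h : x.obj.left.len ≤ n := SimplexCategory.len_le_of_mono x.obj.hom
  exact ⟨⟨⟨x.obj.left.len, by lia⟩, ⟨x.obj.hom, x.property⟩⟩, rfl⟩

instance (n : ℕ) (x y : (properFaces n).FullSubcategory) : Finite (x ⟶ y) :=
  Finite.of_injective (fun a => a.hom.left) fun a b h => by
    ext : 2
    exact h

noncomputable instance (n : ℕ) : FinCategory (properFaces n).FullSubcategory where
  fintypeObj := Fintype.ofFinite _
  fintypeHom _ _ := Fintype.ofFinite _

variable {D : Type u} [Category.{v} D] [HasFiniteLimits D]

/-- The `n`-th matching object. -/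
noncomputable def matchingObj (X : SimplicialObject D) (n : ℕ) : D := limit (matchingDiagram X n)

/-- The projection of the matching object to a proper face. -/
noncomputable def matchingπ (X : SimplicialObject D) {n : ℕ} {k : SimplexCategory} (μ : k ⟶ ⦋n⦌)
    (hμ : Mono μ ∧ ¬ IsIso μ) : matchingObj X n ⟶ X.obj (op k) :=
  limit.π (matchingDiagram X n) (op ⟨Over.mk μ, hμ⟩)

lemma matchingπ_map (X : SimplicialObject D) {n : ℕ} {k l : SimplexCategory} (μ : k ⟶ ⦋n⦌)
    (hμ : Mono μ ∧ ¬ IsIso μ) (α : l ⟶ k) (hαμ : Mono (α ≫ μ) ∧ ¬ IsIso (α ≫ μ)) :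
    matchingπ X μ hμ ≫ X.map α.op = matchingπ X (α ≫ μ) hαμ := by
  let a : (⟨Over.mk (α ≫ μ), hαμ⟩ : (properFaces n).FullSubcategory) ⟶ ⟨Over.mk μ, hμ⟩ :=
    ObjectProperty.homMk (Over.homMk α)
  exact limit.w (matchingDiagram X n) a.op

lemma matchingObj_hom_ext {X : SimplicialObject D} {n : ℕ} {V : D} {f g : V ⟶ matchingObj X n}
    (h : ∀ (k : SimplexCategory) (μ : k ⟶ ⦋n⦌) (hμ : Mono μ ∧ ¬ IsIso μ),
      f ≫ matchingπ X μ hμ = g ≫ matchingπ X μ hμ) : f = g :=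
  limit.hom_ext fun j => h _ j.unop.obj.hom j.unop.property

/-- Maps to the matching object. -/
noncomputable def matchingLift {X : SimplicialObject D} {n : ℕ} {V : D}
    (f : ∀ (k : SimplexCategory) (μ : k ⟶ ⦋n⦌), (Mono μ ∧ ¬ IsIso μ) → (V ⟶ X.obj (op k)))
    (hf : ∀ (k l : SimplexCategory) (μ : k ⟶ ⦋n⦌) (α : l ⟶ k) (hμ : Mono μ ∧ ¬ IsIso μ)
      (hαμ : Mono (α ≫ μ) ∧ ¬ IsIso (α ≫ μ)), f k μ hμ ≫ X.map α.op = f l (α ≫ μ) hαμ) :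
    V ⟶ matchingObj X n :=
  limit.lift (matchingDiagram X n)
    { pt := V
      π :=
        { app j := f _ j.unop.obj.hom j.unop.property
          naturality j j' a := by
            have h : a.unop.hom.left ≫ j.unop.obj.hom = j'.unop.obj.hom := Over.w a.unop.hom
            have h' := hf _ _ j.unop.obj.hom a.unop.hom.left j.unop.property
              (by rw [h]; exact j'.unop.property)
            have congr {ν ν' : j'.unop.obj.left ⟶ ⦋n⦌} (e : ν = ν') (hν) (hν') :
                f _ ν hν = f _ ν' hν' := by subst e; rfl
            exact (Category.id_comp _).trans ((congr h.symm _ _).trans h'.symm) } }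

lemma matchingLift_π {X : SimplicialObject D} {n : ℕ} {V : D}
    (f : ∀ (k : SimplexCategory) (μ : k ⟶ ⦋n⦌), (Mono μ ∧ ¬ IsIso μ) → (V ⟶ X.obj (op k)))
    (hf) (k : SimplexCategory) (μ : k ⟶ ⦋n⦌) (hμ : Mono μ ∧ ¬ IsIso μ) :
    matchingLift (X := X) f hf ≫ matchingπ X μ hμ = f k μ hμ :=
  limit.lift_π _ _

lemma image_ι_mem {n : ℕ} {k : SimplexCategory} (θ : k ⟶ ⦋n⦌) (hθ : ¬ Epi θ) :
    Mono (image.ι θ) ∧ ¬ IsIso (image.ι θ) :=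
  ⟨inferInstance, fun h => hθ (by rw [← image.fac θ]; infer_instance)⟩

/-- The map from the matching object induced by a simplex of the boundary. -/
noncomputable def matchingEval (X : SimplicialObject D) {n : ℕ} {k : SimplexCategory} (θ : k ⟶ ⦋n⦌)
    (hθ : ¬ Epi θ) : matchingObj X n ⟶ X.obj (op k) :=
  matchingπ X (image.ι θ) (image_ι_mem θ hθ) ≫ X.map (factorThruImage θ).op

/-- The image is the smallest subobject through which `θ` factors, so any other factorization
through a proper face receives a map from it. -/
lemma matchingEval_eq (X : SimplicialObject D) {n : ℕ} {k l : SimplexCategory} (θ : k ⟶ ⦋n⦌)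
    (hθ : ¬ Epi θ) (e : k ⟶ l) (μ : l ⟶ ⦋n⦌) (hμ : Mono μ ∧ ¬ IsIso μ) (fac : e ≫ μ = θ) :
    matchingEval X θ hθ = matchingπ X μ hμ ≫ X.map e.op := by
  have := hμ.1
  let F : MonoFactorisation θ := { I := l, m := μ, e := e, fac := fac }
  have h₁ : image.lift F ≫ μ = image.ι θ := image.lift_fac F
  have h₂ : factorThruImage θ ≫ image.lift F = e := by
    rw [← cancel_mono μ, Category.assoc, h₁, image.fac, fac]
  have h₃ := matchingπ_map X μ hμ (image.lift F) (by rw [h₁]; exact image_ι_mem θ hθ)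
  have h₄ : matchingπ X (image.lift F ≫ μ) (by rw [h₁]; exact image_ι_mem θ hθ) =
      matchingπ X (image.ι θ) (image_ι_mem θ hθ) := by
    congr 1
  rw [matchingEval, ← h₄, ← h₃, Category.assoc, ← X.map_comp, ← op_comp, h₂]

lemma matchingEval_of_mono (X : SimplicialObject D) {n : ℕ} {k : SimplexCategory} (μ : k ⟶ ⦋n⦌)
    (hμ : Mono μ ∧ ¬ IsIso μ) (hμ' : ¬ Epi μ) : matchingEval X μ hμ' = matchingπ X μ hμ := by
  rw [matchingEval_eq X μ hμ' (𝟙 _) μ hμ (Category.id_comp _)]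
  simp

lemma not_epi_of_properFace {n : ℕ} {k : SimplexCategory} {μ : k ⟶ ⦋n⦌}
    (hμ : Mono μ ∧ ¬ IsIso μ) : ¬ Epi μ := fun _ =>
  have := hμ.1
  hμ.2 (Balanced.isIso_of_mono_of_epi μ)

lemma not_epi_comp {n : ℕ} {k l : SimplexCategory} {θ : k ⟶ ⦋n⦌} (hθ : ¬ Epi θ) (α : l ⟶ k) :
    ¬ Epi (α ≫ θ) := fun _ => hθ (epi_of_epi α θ)

lemma matchingEval_map (X : SimplicialObject D) {n : ℕ} {k l : SimplexCategory} (θ : k ⟶ ⦋n⦌)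
    (hθ : ¬ Epi θ) (α : l ⟶ k) :
    matchingEval X θ hθ ≫ X.map α.op = matchingEval X (α ≫ θ) (not_epi_comp hθ α) := by
  rw [matchingEval_eq X (α ≫ θ) _ (α ≫ factorThruImage θ) (image.ι θ) (image_ι_mem θ hθ) (by simp),
    matchingEval, Category.assoc, ← X.map_comp, ← op_comp]

/-- The map from `X_n` to the matching object. -/
noncomputable def matchingMap (X : SimplicialObject D) (n : ℕ) :
    X.obj (op ⦋n⦌) ⟶ matchingObj X n :=
  limit.lift _ (matchingCone X n)

lemma matchingMap_π (X : SimplicialObject D) {n : ℕ} {k : SimplexCategory} (μ : k ⟶ ⦋n⦌)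
    (hμ : Mono μ ∧ ¬ IsIso μ) : matchingMap X n ≫ matchingπ X μ hμ = X.map μ.op :=
  limit.lift_π _ _

lemma matchingMap_eval (X : SimplicialObject D) {n : ℕ} {k : SimplexCategory} (θ : k ⟶ ⦋n⦌)
    (hθ : ¬ Epi θ) : matchingMap X n ≫ matchingEval X θ hθ = X.map θ.op := by
  rw [matchingEval, reassoc_of% @matchingMap_π, ← X.map_comp, ← op_comp, image.fac]

/-- The map of matching objects induced by a map of simplicial objects. -/
noncomputable def matchingObjMap {X Y : SimplicialObject D} (φ : X ⟶ Y) (n : ℕ) :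
    matchingObj X n ⟶ matchingObj Y n :=
  matchingLift (fun k μ hμ => matchingπ X μ hμ ≫ φ.app (op k)) fun k l μ α hμ hαμ => by
    rw [Category.assoc, ← φ.naturality, ← Category.assoc, matchingπ_map]

lemma matchingObjMap_π {X Y : SimplicialObject D} (φ : X ⟶ Y) {n : ℕ} {k : SimplexCategory}
    (μ : k ⟶ ⦋n⦌) (hμ : Mono μ ∧ ¬ IsIso μ) :
    matchingObjMap φ n ≫ matchingπ Y μ hμ = matchingπ X μ hμ ≫ φ.app (op k) :=
  matchingLift_π _ _ _ _ _

lemma matchingObjMap_eval {X Y : SimplicialObject D} (φ : X ⟶ Y) {n : ℕ} {k : SimplexCategory}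
    (θ : k ⟶ ⦋n⦌) (hθ : ¬ Epi θ) :
    matchingObjMap φ n ≫ matchingEval Y θ hθ = matchingEval X θ hθ ≫ φ.app (op k) := by
  rw [matchingEval, matchingEval, reassoc_of% @matchingObjMap_π, Category.assoc, φ.naturality]

lemma matchingMap_naturality {X Y : SimplicialObject D} (φ : X ⟶ Y) (n : ℕ) :
    matchingMap X n ≫ matchingObjMap φ n = φ.app (op ⦋n⦌) ≫ matchingMap Y n :=
  matchingObj_hom_ext fun k μ hμ => by
    rw [Category.assoc, Category.assoc, matchingObjMap_π, matchingMap_π, reassoc_of% @matchingMap_π,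
      φ.naturality]

lemma matchingObjMap_comp {X Y Z : SimplicialObject D} (φ : X ⟶ Y) (ψ : Y ⟶ Z) (n : ℕ) :
    matchingObjMap (φ ≫ ψ) n = matchingObjMap φ n ≫ matchingObjMap ψ n :=
  matchingObj_hom_ext fun k μ hμ => by
    simp [matchingObjMap_π, reassoc_of% @matchingObjMap_π]

lemma len_lt_of_properFace {n : ℕ} {k : SimplexCategory} {μ : k ⟶ ⦋n⦌}
    (hμ : Mono μ ∧ ¬ IsIso μ) : k.len < n := by
  have := hμ.1
  refine lt_of_le_of_ne (SimplexCategory.len_le_of_mono μ) fun h => hμ.2 ?_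
  exact (SimplexCategory.isIso_iff_of_mono μ).2 h

/-- Proper faces of [n] have dimension less than n, so only degrees below n matter. -/
lemma isIso_matchingObjMap {X Y : SimplicialObject D} (φ : X ⟶ Y) (n : ℕ)
    (h : ∀ k : SimplexCategory, k.len < n → IsIso (φ.app (op k))) :
    IsIso (matchingObjMap φ n) := by
  have h' (k : SimplexCategory) (μ : k ⟶ ⦋n⦌) (hμ : Mono μ ∧ ¬ IsIso μ) : IsIso (φ.app (op k)) :=
    h k (len_lt_of_properFace hμ)
  refine ⟨matchingLift (fun k μ hμ => matchingπ Y μ hμ ≫ @inv _ _ _ _ (φ.app (op k)) (h' k μ hμ))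
    (fun k l μ α hμ hαμ => ?_), matchingObj_hom_ext fun k μ hμ => ?_,
      matchingObj_hom_ext fun k μ hμ => ?_⟩
  · have := h' _ _ hμ
    have := h' _ _ hαμ
    rw [← matchingπ_map Y μ hμ α hαμ, IsIso.eq_comp_inv, Category.assoc, Category.assoc,
      φ.naturality, IsIso.inv_hom_id_assoc]
  · have := h' _ _ hμ
    simp [matchingLift_π, reassoc_of% @matchingObjMap_π]
  · have := h' _ _ hμ
    simp [reassoc_of% @matchingLift_π, matchingObjMap_π]

/-- The relative matching object of a map of simplicial objects. -/
noncomputable abbrev relMatchingObj {X Y : SimplicialObject D} (φ : X ⟶ Y) (n : ℕ) : D :=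
  pullback (matchingObjMap φ n) (matchingMap Y n)

/-- The relative matching map of a map of simplicial objects. -/
noncomputable def relMatchingMap {X Y : SimplicialObject D} (φ : X ⟶ Y) (n : ℕ) :
    X.obj (op ⦋n⦌) ⟶ relMatchingObj φ n :=
  pullback.lift (matchingMap X n) (φ.app _) (matchingMap_naturality φ n)

@[simp]
lemma relMatchingMap_fst {X Y : SimplicialObject D} (φ : X ⟶ Y) (n : ℕ) :
    relMatchingMap φ n ≫ pullback.fst _ _ = matchingMap X n := pullback.lift_fst _ _ _

@[simp]
lemma relMatchingMap_snd {X Y : SimplicialObject D} (φ : X ⟶ Y) (n : ℕ) :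
    relMatchingMap φ n ≫ pullback.snd _ _ = φ.app _ := pullback.lift_snd _ _ _

/-- If `ι : X ⟶ X'` is an isomorphism in degrees less than `n`, the relative matching objects of
`ι ≫ ψ` and `ψ` are isomorphic. -/
lemma exists_relMatching_iso {X X' Y : SimplicialObject D} (ι : X ⟶ X') (ψ : X' ⟶ Y) (φ : X ⟶ Y)
    (fac : ι ≫ ψ = φ) (n : ℕ) (h : ∀ k : SimplexCategory, k.len < n → IsIso (ι.app (op k))) :
    ∃ κ : relMatchingObj φ n ≅ relMatchingObj ψ n,
      κ.hom ≫ pullback.fst _ _ = pullback.fst _ _ ≫ matchingObjMap ι n ∧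
      κ.hom ≫ pullback.snd _ _ = pullback.snd _ _ := by
  subst fac
  have := isIso_matchingObjMap ι n h
  let k : relMatchingObj (ι ≫ ψ) n ⟶ relMatchingObj ψ n :=
    pullback.map _ _ _ _ (matchingObjMap ι n) (𝟙 _) (𝟙 _)
      (by rw [Category.comp_id, matchingObjMap_comp]) (by simp)
  have : IsIso k := pullback.map_isIso _ _ _ _ _ _ _ _ _
  exact ⟨asIso k, pullback.lift_fst _ _ _, (pullback.lift_snd _ _ _).trans (Category.comp_id _)⟩

/-- A map of simplicial objects is a Reedy fibration with respect to a class `Fib` if all its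
relative matching maps belong to this class. -/
def ReedyFibration (Fib : MorphismProperty D) {X Y : SimplicialObject D} (φ : X ⟶ Y) : Prop :=
  ∀ n : ℕ, Fib (relMatchingMap φ n)

lemma fib_relMatchingMap_of_iso (Fib : MorphismProperty D) [Fib.RespectsIso]
    {X X' Y : SimplicialObject D} (ι : X ⟶ X') (ψ : X' ⟶ Y) (n : ℕ)
    (h : ∀ k : SimplexCategory, k.len ≤ n → IsIso (ι.app (op k)))
    (hfib : Fib (relMatchingMap (ι ≫ ψ) n)) : Fib (relMatchingMap ψ n) := by
  obtain ⟨κ, hκ₁, hκ₂⟩ := exists_relMatching_iso ι ψ _ rfl n fun k hk => h k hk.le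
  have := h ⦋n⦌ le_rfl
  have fac : relMatchingMap (ι ≫ ψ) n ≫ κ.hom = ι.app _ ≫ relMatchingMap ψ n := by
    apply pullback.hom_ext
    · rw [Category.assoc, hκ₁, reassoc_of% @relMatchingMap_fst, Category.assoc, relMatchingMap_fst,
        matchingMap_naturality]
    · rw [Category.assoc, hκ₂, relMatchingMap_snd, Category.assoc, relMatchingMap_snd]
      rfl
  have h₂ : relMatchingMap ψ n = inv (ι.app (op ⦋n⦌)) ≫ relMatchingMap (ι ≫ ψ) n ≫ κ.hom := by
    rw [fac, IsIso.inv_hom_id_assoc]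
  rw [h₂, Fib.cancel_left_of_respectsIso, Fib.cancel_right_of_respectsIso]
  exact hfib

end Matching

/-! ### Replacing one degree of a simplicial object -/

section Attach

variable {D : Type u} [Category.{v} D] [HasFiniteLimits D]

/-- A factorization of the map from `Y_n` to the `n`-th matching object. -/
structure MatchingFactorization (Y : SimplicialObject D) (n : ℕ) where
  /-- the middle object -/
  Z : D
  /-- the first map -/
  t : Y.obj (op ⦋n⦌) ⟶ Z
  /-- the second map -/
  q : Z ⟶ matchingObj Y n
  fac : t ≫ q = matchingMap Y n

namespace MatchingFactorization

attribute [simp] fac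

variable [HasFiniteColimits D] {Y : SimplicialObject D} {n : ℕ} (A : MatchingFactorization Y n)

/-- The degree `k` part of the simplicial object obtained by replacing `Y_n` by the middle object
of a factorization of the matching map. -/
noncomputable abbrev attachObj (k : SimplexCategory) : D :=
  pushout (Limits.Sigma.desc fun θ : {θ : k ⟶ ⦋n⦌ // Epi θ} => Y.map θ.1.op)
    (Limits.Sigma.map fun _ : {θ : k ⟶ ⦋n⦌ // Epi θ} => A.t)

/-- The inclusion of the original simplicial object. -/
noncomputable def inclObj (k : SimplexCategory) : Y.obj (op k) ⟶ A.attachObj k := pushout.inl _ _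

open Classical in
/-- The simplices of the new object given by the middle object. -/
noncomputable def simplex {k : SimplexCategory} (θ : k ⟶ ⦋n⦌) : A.Z ⟶ A.attachObj k :=
  if hθ : Epi θ then
    Sigma.ι (fun _ : {θ : k ⟶ ⦋n⦌ // Epi θ} => A.Z) ⟨θ, hθ⟩ ≫ pushout.inr _ _
  else A.q ≫ matchingEval Y θ hθ ≫ A.inclObj k

lemma simplex_of_not_epi {k : SimplexCategory} (θ : k ⟶ ⦋n⦌) (hθ : ¬ Epi θ) :
    A.simplex θ = A.q ≫ matchingEval Y θ hθ ≫ A.inclObj k := dif_neg hθ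

lemma simplex_of_epi {k : SimplexCategory} (θ : k ⟶ ⦋n⦌) (hθ : Epi θ) :
    A.simplex θ = Sigma.ι (fun _ : {θ : k ⟶ ⦋n⦌ // Epi θ} => A.Z) ⟨θ, hθ⟩ ≫ pushout.inr _ _ :=
  dif_pos hθ

/-- For epi `θ` this is the pushout relation, otherwise it is the factorization of the matching map.
Having it uniformly in `θ` allows the structure maps to be defined without separating the cases. -/
lemma t_simplex {k : SimplexCategory} (θ : k ⟶ ⦋n⦌) :
    A.t ≫ A.simplex θ = Y.map θ.op ≫ A.inclObj k := by
  by_cases hθ : Epi θ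
  · rw [A.simplex_of_epi θ hθ]
    have h := Sigma.ι (fun _ : {θ : k ⟶ ⦋n⦌ // Epi θ} => Y.obj (op ⦋n⦌)) ⟨θ, hθ⟩ ≫=
      pushout.condition (f := Limits.Sigma.desc fun θ : {θ : k ⟶ ⦋n⦌ // Epi θ} => Y.map θ.1.op)
        (g := Limits.Sigma.map fun _ : {θ : k ⟶ ⦋n⦌ // Epi θ} => A.t)
    simpa [inclObj] using h.symm
  · rw [A.simplex_of_not_epi θ hθ, reassoc_of% A.fac, reassoc_of% @matchingMap_eval]

lemma attachObj_hom_ext {k : SimplexCategory} {W : D} {f g : A.attachObj k ⟶ W}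
    (h₁ : A.inclObj k ≫ f = A.inclObj k ≫ g)
    (h₂ : ∀ θ : k ⟶ ⦋n⦌, Epi θ → A.simplex θ ≫ f = A.simplex θ ≫ g) : f = g := by
  apply pushout.hom_ext h₁
  refine Sigma.hom_ext _ _ fun ⟨θ, hθ⟩ => ?_
  have := h₂ θ hθ
  rwa [A.simplex_of_epi θ hθ, Category.assoc, Category.assoc] at this

/-- Maps out of the new simplicial object in a given degree. -/
noncomputable def attachDesc {k : SimplexCategory} {W : D} (a : Y.obj (op k) ⟶ W)
    (b : (k ⟶ ⦋n⦌) → (A.Z ⟶ W)) (h : ∀ θ : k ⟶ ⦋n⦌, Epi θ → A.t ≫ b θ = Y.map θ.op ≫ a) :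
    A.attachObj k ⟶ W :=
  pushout.desc a (Limits.Sigma.desc fun θ => b θ.1)
    (Sigma.hom_ext _ _ fun ⟨θ, hθ⟩ => by simp [h θ hθ])

@[simp]
lemma inclObj_attachDesc {k : SimplexCategory} {W : D} (a : Y.obj (op k) ⟶ W)
    (b : (k ⟶ ⦋n⦌) → (A.Z ⟶ W)) (h) : A.inclObj k ≫ A.attachDesc a b h = a :=
  pushout.inl_desc _ _ _

@[simp]
lemma inclObj_attachDesc_assoc {k : SimplexCategory} {W V : D} (a : Y.obj (op k) ⟶ W)
    (b : (k ⟶ ⦋n⦌) → (A.Z ⟶ W)) (h) (g : W ⟶ V) :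
    A.inclObj k ≫ A.attachDesc a b h ≫ g = a ≫ g := by
  rw [← Category.assoc, inclObj_attachDesc]

lemma simplex_attachDesc_of_epi {k : SimplexCategory} {W : D} (a : Y.obj (op k) ⟶ W)
    (b : (k ⟶ ⦋n⦌) → (A.Z ⟶ W)) (h) (θ : k ⟶ ⦋n⦌) (hθ : Epi θ) :
    A.simplex θ ≫ A.attachDesc a b h = b θ := by
  rw [A.simplex_of_epi θ hθ, attachDesc, Category.assoc, pushout.inr_desc, Sigma.ι_desc]

lemma simplex_attachDesc {k : SimplexCategory} {W : D} (a : Y.obj (op k) ⟶ W)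
    (b : (k ⟶ ⦋n⦌) → (A.Z ⟶ W)) (h)
    (h' : ∀ (θ : k ⟶ ⦋n⦌) (hθ : ¬ Epi θ), A.q ≫ matchingEval Y θ hθ ≫ a = b θ) (θ : k ⟶ ⦋n⦌) :
    A.simplex θ ≫ A.attachDesc a b h = b θ := by
  by_cases hθ : Epi θ
  · exact A.simplex_attachDesc_of_epi a b h θ hθ
  · rw [A.simplex_of_not_epi θ hθ, Category.assoc, Category.assoc, inclObj_attachDesc, h' θ hθ]

/-- The structure maps of the new simplicial object. -/
noncomputable def attachMap {k l : SimplexCategory} (α : l ⟶ k) : A.attachObj k ⟶ A.attachObj l :=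
  A.attachDesc (Y.map α.op ≫ A.inclObj l) (fun θ => A.simplex (α ≫ θ)) fun θ _ => by
    rw [t_simplex, op_comp, Y.map_comp, Category.assoc]

@[simp]
lemma inclObj_attachMap {k l : SimplexCategory} (α : l ⟶ k) :
    A.inclObj k ≫ A.attachMap α = Y.map α.op ≫ A.inclObj l := by
  simp [attachMap]

@[simp]
lemma inclObj_attachMap_assoc {k l : SimplexCategory} (α : l ⟶ k) {V : D}
    (g : A.attachObj l ⟶ V) :
    A.inclObj k ≫ A.attachMap α ≫ g = Y.map α.op ≫ A.inclObj l ≫ g := by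
  rw [← Category.assoc, inclObj_attachMap, Category.assoc]

@[simp]
lemma simplex_attachMap {k l : SimplexCategory} (α : l ⟶ k) (θ : k ⟶ ⦋n⦌) :
    A.simplex θ ≫ A.attachMap α = A.simplex (α ≫ θ) :=
  A.simplex_attachDesc _ _ _ (fun θ hθ => by
    rw [reassoc_of% @matchingEval_map, A.simplex_of_not_epi _ (not_epi_comp hθ α)]) θ

@[simp]
lemma simplex_attachMap_assoc {k l : SimplexCategory} (α : l ⟶ k) (θ : k ⟶ ⦋n⦌) {V : D}
    (g : A.attachObj l ⟶ V) : A.simplex θ ≫ A.attachMap α ≫ g = A.simplex (α ≫ θ) ≫ g := by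
  rw [← Category.assoc, simplex_attachMap]

/-- The simplicial object obtained by replacing `Y_n` by the middle object of a factorization of
the matching map, and adding degeneracies of the new simplices freely. -/
noncomputable abbrev attach : SimplicialObject D where
  obj k := A.attachObj k.unop
  map α := A.attachMap α.unop
  map_id k := A.attachObj_hom_ext (by simp) (by simp)
  map_comp α β := A.attachObj_hom_ext (by simp) (by simp)

/-- The map from the original simplicial object. -/
@[simps]
noncomputable def incl : Y ⟶ A.attach where
  app k := A.inclObj k.unop
  naturality k l α := by simp

/-- Maps out of the new simplicial object. -/
@[simps]
noncomputable def desc {B : SimplicialObject D} (ψ : Y ⟶ B) (b : A.Z ⟶ B.obj (op ⦋n⦌))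
    (hb : A.t ≫ b = ψ.app _) (hb' : A.q ≫ matchingObjMap ψ n = b ≫ matchingMap B n) :
    A.attach ⟶ B where
  app k := A.attachDesc (ψ.app k) (fun θ => b ≫ B.map θ.op) fun θ _ => by
    rw [reassoc_of% hb, ψ.naturality]
  naturality k l α := by
    have h (k : SimplexCategoryᵒᵖ) (θ : k.unop ⟶ ⦋n⦌) :
        A.simplex θ ≫ A.attachDesc (ψ.app k) (fun θ => b ≫ B.map θ.op) (fun θ _ => by
          rw [reassoc_of% hb, ψ.naturality]) = b ≫ B.map θ.op :=
      A.simplex_attachDesc _ _ _ (fun θ hθ => by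
        have := matchingObjMap_eval ψ θ hθ
        erw [← this]
        rw [reassoc_of% hb', matchingMap_eval]) θ
    refine A.attachObj_hom_ext (by simp) fun θ _ => ?_
    rw [← Category.assoc, ← Category.assoc, h k θ, simplex_attachMap, h l]
    simp

@[simp]
lemma incl_desc {B : SimplicialObject D} (ψ : Y ⟶ B) (b : A.Z ⟶ B.obj (op ⦋n⦌)) (hb) (hb') :
    A.incl ≫ A.desc ψ b hb hb' = ψ := by
  ext k
  simp

/-- There is no epimorphism from [k] onto [n] when k < n, so nothing is attached. -/
lemma isIso_inclObj (k : SimplexCategory) (hk : k.len < n) : IsIso (A.inclObj k) := by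
  have h (θ : k ⟶ ⦋n⦌) : ¬ Epi θ := fun _ => by
    have := SimplexCategory.len_le_of_epi θ
    simp at this
    lia
  exact ⟨A.attachDesc (𝟙 _) (fun θ => A.q ≫ matchingEval Y θ (h θ)) (fun θ hθ => (h θ hθ).elim),
    by simp, A.attachObj_hom_ext (by simp) (fun θ hθ => (h θ hθ).elim)⟩

/-- The only epi endomorphism of [n] is the identity, so a single copy of Z is glued along Y_n
itself and degree n becomes Z. -/
lemma isIso_simplex_id : IsIso (A.simplex (𝟙 ⦋n⦌)) := by
  have h (θ : ⦋n⦌ ⟶ ⦋n⦌) (_ : Epi θ) : θ = 𝟙 _ := SimplexCategory.eq_id_of_epi θ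
  refine ⟨A.attachDesc A.t (fun _ => 𝟙 _) (fun θ hθ => by simp [h θ hθ]),
    A.simplex_attachDesc_of_epi _ _ _ _ inferInstance, A.attachObj_hom_ext ?_ fun θ hθ => ?_⟩
  · simp [t_simplex]
  · rw [← Category.assoc, A.simplex_attachDesc_of_epi _ _ _ _ hθ, h θ hθ]
    simp

/-- The inclusion is a cobase change of a coproduct of copies of `t`; the lift is assembled from
lifts on each copy. -/
lemma llp_inclObj (P : MorphismProperty D) (ht : P.llp A.t) (k : SimplexCategory) :
    P.llp (A.inclObj k) := fun E F p hp => by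
  have := ht p hp
  refine ⟨fun {f g} sq => ?_⟩
  have sq' (θ : k ⟶ ⦋n⦌) : CommSq (Y.map θ.op ≫ f) A.t p (A.simplex θ ≫ g) :=
    ⟨by rw [Category.assoc, sq.w, reassoc_of% A.t_simplex]⟩
  exact ⟨⟨⟨A.attachDesc f (fun θ => (sq' θ).lift) (fun θ _ => (sq' θ).fac_left), by simp,
    A.attachObj_hom_ext (by simp [sq.w]) fun θ hθ => by
      rw [← Category.assoc, A.simplex_attachDesc_of_epi _ _ _ _ hθ, (sq' θ).fac_right]⟩⟩⟩

/-- The relative matching map in degree `n` of the new simplicial object. -/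
lemma fib_relMatchingMap_desc {B : SimplicialObject D} (ψ : Y ⟶ B) (b : A.Z ⟶ B.obj (op ⦋n⦌))
    (hb) (hb') (Fib : MorphismProperty D) [Fib.RespectsIso]
    (hfib : Fib (pullback.lift A.q b hb' : A.Z ⟶ relMatchingObj ψ n)) :
    Fib (relMatchingMap (A.desc ψ b hb hb') n) := by
  obtain ⟨κ, hκ₁, hκ₂⟩ := exists_relMatching_iso A.incl (A.desc ψ b hb hb') ψ (by simp) n
    fun k hk => A.isIso_inclObj k hk
  have := A.isIso_simplex_id
  have fac : pullback.lift A.q b hb' ≫ κ.hom =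
      A.simplex (𝟙 ⦋n⦌) ≫ relMatchingMap (A.desc ψ b hb hb') n := by
    apply pullback.hom_ext
    · rw [Category.assoc, Category.assoc, hκ₁, relMatchingMap_fst,
        pullback.lift_fst_assoc]
      refine matchingObj_hom_ext fun k μ hμ => ?_
      rw [Category.assoc, Category.assoc, matchingObjMap_π, matchingMap_π]
      have := A.simplex_attachMap μ (𝟙 ⦋n⦌)
      erw [this]
      rw [Category.comp_id, A.simplex_of_not_epi μ (not_epi_of_properFace hμ),
        matchingEval_of_mono _ _ hμ]
      rfl
    · rw [Category.assoc, Category.assoc, hκ₂, relMatchingMap_snd,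
        pullback.lift_snd]
      have := A.simplex_attachDesc_of_epi (ψ.app (op ⦋n⦌)) (fun θ => b ≫ B.map θ.op)
        (fun θ _ => by rw [reassoc_of% hb, ψ.naturality]) (𝟙 ⦋n⦌) inferInstance
      simpa using this.symm
  have h₂ : relMatchingMap (A.desc ψ b hb hb') n =
      inv (A.simplex (𝟙 ⦋n⦌)) ≫ pullback.lift A.q b hb' ≫ κ.hom := by
    rw [fac, IsIso.inv_hom_id_assoc]
  rw [h₂, Fib.cancel_left_of_respectsIso, Fib.cancel_right_of_respectsIso]
  exact hfib

end MatchingFactorization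

end Attach

/-! ### Reedy factorizations as sequential colimits that stabilize in each degree -/

section ReedyFactorization

variable {D : Type u} [Category.{v} D]

/-- A sequence of simplicial objects which is eventually constant in each degree has a colimit. -/
lemma exists_colimit_of_eventually_isIso {X : ℕ → SimplicialObject D} (ι : ∀ n, X n ⟶ X (n + 1))
    (h : ∀ n (k : SimplexCategory), k.len < n → IsIso ((ι n).app (op k))) :
    ∃ (C : SimplicialObject D) (j : ∀ n, X n ⟶ C), (∀ n, ι n ≫ j (n + 1) = j n) ∧
      (∀ n (k : SimplexCategory), k.len < n → IsIso ((j n).app (op k))) ∧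
      ∀ (B : SimplicialObject D) (ψ : ∀ n, X n ⟶ B), (∀ n, ι n ≫ ψ (n + 1) = ψ n) →
        ∃ π : C ⟶ B, ∀ n, j n ≫ π = ψ n := by
  let F : ℕ ⥤ SimplicialObject D := Functor.ofSequence ι
  have hF₀ (n : ℕ) : F.map (homOfLE (Nat.le_add_right n 1)) = ι n :=
    Functor.ofSequence_map_homOfLE_succ ι n
  have hF (k : SimplexCategoryᵒᵖ) :
      (F ⋙ (evaluation _ _).obj k).IsEventuallyConstantFrom (k.unop.len + 1) := by
    intro j f
    obtain ⟨m, rfl⟩ := Nat.exists_eq_add_of_le (leOfHom f)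
    obtain rfl := Subsingleton.elim f (homOfLE (by lia))
    induction m with
    | zero => exact inferInstanceAs (IsIso ((F ⋙ (evaluation _ _).obj k).map (𝟙 _)))
    | succ m ih =>
      have h₁ := ih
      have h₂ : IsIso ((F ⋙ (evaluation _ _).obj k).map
          (homOfLE (Nat.le_add_right (k.unop.len + 1 + m) 1))) := by
        change IsIso ((F.map (homOfLE (Nat.le_add_right (k.unop.len + 1 + m) 1))).app k)
        rw [hF₀]
        exact h _ k.unop (by lia)
      have := IsIso.comp_isIso' h₁ h₂
      rwa [← Functor.map_comp] at this
  have (k : SimplexCategoryᵒᵖ) : HasColimit (Functor.flip F |>.obj k) := (hF k).hasColimit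
  have : HasColimit F := functorCategoryHasColimit F
  refine ⟨colimit F, colimit.ι F, fun n => ?_, fun n k hk => ?_, fun B ψ hψ => ?_⟩
  · rw [← hF₀]
    exact colimit.w F (homOfLE (Nat.le_add_right n 1))
  · exact (hF (op k)).isIso_ι_of_isColimit'
      (isColimitOfPreserves ((evaluation _ _).obj (op k)) (colimit.isColimit F)) n (homOfLE hk)
  · let c : Cocone F :=
      { pt := B
        ι := NatTrans.ofSequence ψ (fun n => by
          rw [hF₀]
          exact (hψ n).trans (Category.comp_id _).symm) }
    exact ⟨colimit.desc F c, fun n => colimit.ι_desc c n⟩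

variable [HasFiniteLimits D] [HasFiniteColimits D]

/-- One step of the construction of Reedy factorizations. -/
lemma exists_attach (Fib : MorphismProperty D) [Fib.RespectsIso] (good : ObjectProperty D)
    (hfac : ∀ {X Y : D} (f : X ⟶ Y), good X →
      ∃ (Z : D) (i : X ⟶ Z) (p : Z ⟶ Y), Fib.llp i ∧ Fib p ∧ i ≫ p = f)
    (n : ℕ) {Y B : SimplicialObject D} (ψ : Y ⟶ B) (hY : ∀ k, good (Y.obj k)) :
    ∃ (Y' : SimplicialObject D) (ι : Y ⟶ Y') (ψ' : Y' ⟶ B), ι ≫ ψ' = ψ ∧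
      (∀ k, Fib.llp (ι.app k)) ∧
      (∀ k : SimplexCategory, k.len < n → IsIso (ι.app (op k))) ∧ Fib (relMatchingMap ψ' n) := by
  -- Factoring the relative matching map, rather than the matching map, produces both the new degree
  -- n and its map to `B`.
  obtain ⟨Z, t, p, ht, hp, fac⟩ := hfac (relMatchingMap ψ n) (hY _)
  let A : MatchingFactorization Y n :=
    { Z := Z, t := t, q := p ≫ pullback.fst _ _,
      fac := by rw [reassoc_of% fac, relMatchingMap_fst] }
  have hb : A.t ≫ (p ≫ pullback.snd _ _) = ψ.app _ := by
    rw [← Category.assoc]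
    exact (fac =≫ _).trans (relMatchingMap_snd _ _)
  have hb' : A.q ≫ matchingObjMap ψ n = (p ≫ pullback.snd _ _) ≫ matchingMap B n := by
    simp [A, pullback.condition]
  refine ⟨A.attach, A.incl, A.desc ψ _ hb hb', by simp, fun k => A.llp_inclObj Fib ht k.unop,
    fun k hk => A.isIso_inclObj k hk, A.fib_relMatchingMap_desc ψ _ hb hb' Fib ?_⟩
  convert hp
  apply pullback.hom_ext
  · rw [pullback.lift_fst]
  · rw [pullback.lift_snd]

/-- Reedy factorizations. -/
theorem exists_reedy_factorization (Fib : MorphismProperty D) [Fib.RespectsIso] (good : ObjectProperty D)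
    (hfac : ∀ {X Y : D} (f : X ⟶ Y), good X →
      ∃ (Z : D) (i : X ⟶ Z) (p : Z ⟶ Y), Fib.llp i ∧ Fib p ∧ i ≫ p = f)
    (hgood : ∀ {X Y : D} (i : X ⟶ Y), good X → Fib.llp i → good Y)
    {Y B : SimplicialObject D} (ψ : Y ⟶ B) (hY : ∀ k, good (Y.obj k)) :
    ∃ (X : SimplicialObject D) (ι : Y ⟶ X) (π : X ⟶ B), ι ≫ π = ψ ∧
      (∀ k, Fib.llp (ι.app k)) ∧ ReedyFibration Fib π := by
  -- The stages carry goodness of every degree, because the next factorization is available only for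
  -- good domains.
  let St := {p : Over B // ∀ k, good (p.left.obj k)}
  have step (n : ℕ) (s : St) : ∃ s' : St, ∃ ι : s.1.left ⟶ s'.1.left, ι ≫ s'.1.hom = s.1.hom ∧
      (∀ k, Fib.llp (ι.app k)) ∧
      (∀ k : SimplexCategory, k.len < n → IsIso (ι.app (op k))) ∧
      Fib (relMatchingMap s'.1.hom n) := by
    obtain ⟨Y', ι, ψ', h₁, h₂, h₃, h₄⟩ := exists_attach Fib good hfac n s.1.hom s.2
    exact ⟨⟨Over.mk ψ', fun k => hgood _ (s.2 k) (h₂ k)⟩, ι, h₁, h₂, h₃, h₄⟩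
  choose next ι hι hllp hiso hfib using step
  let s : ℕ → St := fun n => Nat.rec ⟨Over.mk ψ, hY⟩ next n
  obtain ⟨C, j, hj, hj', hC⟩ := exists_colimit_of_eventually_isIso
    (X := fun n => (s n).1.left) (fun n => ι n (s n)) (fun n => hiso n (s n))
  obtain ⟨π, hπ⟩ := hC B (fun n => (s n).1.hom) fun n => hι n (s n)
  refine ⟨C, j 0, π, hπ 0, fun k => ?_, fun n => ?_⟩
  -- Degree k is stable from stage k + 1 on, so the inclusion there is a finite composite of maps in
  -- `Fib.llp`, up to isomorphism.
  · have h (n : ℕ) : ∃ f : (s 0).1.left ⟶ (s n).1.left, f ≫ j n = j 0 ∧ Fib.llp (f.app k) := by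
      induction n with
      | zero => exact ⟨𝟙 _, Category.id_comp _, Fib.llp.id_mem _⟩
      | succ n ih =>
        obtain ⟨f, hf, hf'⟩ := ih
        exact ⟨f ≫ ι n (s n), by rw [Category.assoc, hj n, hf],
          Fib.llp.comp_mem _ _ hf' (hllp _ _ k)⟩
    obtain ⟨f, hf, hf'⟩ := h (k.unop.len + 1)
    have := hj' (k.unop.len + 1) k.unop (by lia)
    rw [← hf]
    exact (Fib.llp.cancel_right_of_respectsIso _ _).2 hf'
  -- Stage n + 1 is the first whose degree n has been repaired, and its map to the colimit is
  -- invertible in degrees at most n, just as the lemma requires.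
  · refine fib_relMatchingMap_of_iso Fib (j (n + 1)) π n (fun k hk => hj' _ k (by lia)) ?_
    rw [hπ]
    exact hfib n (s n)

end ReedyFactorization

/-! ### Lifting problems for D(X, A_•) and for relative matching maps -/

section HomComplex

variable {D : Type u} [Category.{v} D]

/-- The simplicial set `D(X, A_•)`. -/
abbrev homSSet (X : D) (A : SimplicialObject D) : SSet.{v} :=
  ((SimplicialObject.whiskering D (Type v)).obj (coyoneda.obj (op X))).obj A

/-- The map `D(V, A_•) ⟶ D(U, A_•)` induced by `i : U ⟶ V`. -/
abbrev homPre {U V : D} (i : U ⟶ V) (A : SimplicialObject D) : homSSet V A ⟶ homSSet U A :=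
  ((SimplicialObject.whiskering D (Type v)).map (coyoneda.map i.op)).app A

lemma homMap_comp (X : D) {A B C : SimplicialObject D} (φ : A ⟶ B) (ψ : B ⟶ C) :
    homMap X (φ ≫ ψ) = homMap X φ ≫ homMap X ψ := by
  simp [homMap]

lemma homMap_id (X : D) (A : SimplicialObject D) : homMap X (𝟙 A) = 𝟙 _ := by
  simp [homMap]

lemma homMap_homPre {U V : D} (i : U ⟶ V) {A B : SimplicialObject D} (φ : A ⟶ B) :
    homPre i A ≫ homMap U φ = homMap V φ ≫ homPre i B :=
  ((SimplicialObject.whiskering D (Type v)).map (coyoneda.map i.op)).naturality φ |>.symm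

/-- The Yoneda bijection for `D(X, A_•)`. -/
def simplexEquiv (X : D) (A : SimplicialObject D) (n : ℕ) :
    (Δ[n] ⟶ homSSet X A) ≃ (X ⟶ A.obj (op ⦋n⦌)) := SSet.yonedaEquiv

lemma simplexEquiv_homMap {X : D} {A B : SimplicialObject D} (φ : A ⟶ B) {n : ℕ}
    (g : Δ[n] ⟶ homSSet X A) :
    simplexEquiv X B n (g ≫ homMap X φ) = simplexEquiv X A n g ≫ φ.app (op ⦋n⦌) := rfl

lemma simplexEquiv_homPre {U V : D} (i : U ⟶ V) {A : SimplicialObject D} {n : ℕ}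
    (g : Δ[n] ⟶ homSSet V A) :
    simplexEquiv U A n (g ≫ homPre i A) = i ≫ simplexEquiv V A n g := rfl

lemma not_epi_of_mem_boundary {n : ℕ} {k : SimplexCategoryᵒᵖ} (x : Δ[n].obj k)
    (hx : x ∈ (SSet.boundary.{v} n).obj k) : ¬ Epi (SSet.stdSimplex.objEquiv x) := by
  rw [SimplexCategory.epi_iff_surjective]
  exact hx

lemma mem_boundary_of_not_epi {n : ℕ} {k : SimplexCategoryᵒᵖ} (θ : k.unop ⟶ ⦋n⦌) (hθ : ¬ Epi θ) :
    SSet.stdSimplex.objEquiv.symm θ ∈ (SSet.boundary.{v} n).obj k := by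
  rw [SimplexCategory.epi_iff_surjective] at hθ
  exact hθ

/-- The value of a map from `∂Δ[n]` on a simplex of the boundary. -/
def boundaryVal {V : D} {A : SimplicialObject D} {n : ℕ}
    (g : (SSet.boundary.{v} n : SSet.{v}) ⟶ homSSet V A) {k : SimplexCategory} (θ : k ⟶ ⦋n⦌)
    (hθ : ¬ Epi θ) : V ⟶ A.obj (op k) :=
  g.app (op k) ⟨SSet.stdSimplex.objEquiv.symm θ, mem_boundary_of_not_epi (k := op k) θ hθ⟩

lemma boundaryVal_map {V : D} {A : SimplicialObject D} {n : ℕ}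
    (g : (SSet.boundary.{v} n : SSet.{v}) ⟶ homSSet V A) {k l : SimplexCategory} (θ : k ⟶ ⦋n⦌)
    (hθ : ¬ Epi θ) (α : l ⟶ k) :
    boundaryVal g θ hθ ≫ A.map α.op = boundaryVal g (α ≫ θ) (not_epi_comp hθ α) :=
  (ConcreteCategory.congr_hom (C := Type v) (g.naturality α.op) _).symm

lemma boundaryVal_congr {V : D} {A : SimplicialObject D} {n : ℕ}
    (g : (SSet.boundary.{v} n : SSet.{v}) ⟶ homSSet V A) {k : SimplexCategory} {θ θ' : k ⟶ ⦋n⦌}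
    (e : θ = θ') (hθ : ¬ Epi θ) (hθ' : ¬ Epi θ') : boundaryVal g θ hθ = boundaryVal g θ' hθ' := by
  subst e
  rfl

lemma boundary_hom_ext {V : D} {A : SimplicialObject D} {n : ℕ}
    {g g' : (SSet.boundary.{v} n : SSet.{v}) ⟶ homSSet V A}
    (h : ∀ (k : SimplexCategory) (θ : k ⟶ ⦋n⦌) (hθ : ¬ Epi θ),
      boundaryVal g θ hθ = boundaryVal g' θ hθ) : g = g' := by
  ext k x
  exact h _ (SSet.stdSimplex.objEquiv x.1) (not_epi_of_mem_boundary _ x.2)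

lemma boundaryVal_ι_comp {V : D} {A : SimplicialObject D} {n : ℕ} (g : Δ[n] ⟶ homSSet V A)
    {k : SimplexCategory} (θ : k ⟶ ⦋n⦌) (hθ : ¬ Epi θ) :
    boundaryVal ((SSet.boundary.{v} n).ι ≫ g) θ hθ = simplexEquiv V A n g ≫ A.map θ.op := by
  refine Eq.trans ?_ (ConcreteCategory.congr_hom (C := Type v) (g.naturality θ.op)
    (SSet.stdSimplex.objEquiv.symm (𝟙 _)))
  refine congrArg (g.app (op k)) (SSet.stdSimplex.objEquiv.injective ?_)
  exact (Category.comp_id θ).symm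

/-- The map `D(V, A) ⟶ D(U, A) ×_{D(U, B)} D(V, B)`. -/
noncomputable def pullbackHom {U V : D} (i : U ⟶ V) {A B : SimplicialObject D} (φ : A ⟶ B) :
    homSSet V A ⟶ pullback (homMap U φ) (homPre i B) :=
  pullback.lift (homPre i A) (homMap V φ) (homMap_homPre i φ)

@[simp]
lemma pullbackHom_fst {U V : D} (i : U ⟶ V) {A B : SimplicialObject D} (φ : A ⟶ B) :
    pullbackHom i φ ≫ pullback.fst _ _ = homPre i A := pullback.lift_fst _ _ _

@[simp]
lemma pullbackHom_snd {U V : D} (i : U ⟶ V) {A B : SimplicialObject D} (φ : A ⟶ B) :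
    pullbackHom i φ ≫ pullback.snd _ _ = homMap V φ := pullback.lift_snd _ _ _

variable [HasFiniteLimits D]

/-- The map to the matching object given by a map out of `∂Δ[n]`. -/
noncomputable def boundaryToMatching {V : D} {A : SimplicialObject D} {n : ℕ}
    (g : (SSet.boundary.{v} n : SSet.{v}) ⟶ homSSet V A) : V ⟶ matchingObj A n :=
  matchingLift (fun _ μ hμ => boundaryVal g μ (not_epi_of_properFace hμ))
    fun _ _ _ _ _ _ => boundaryVal_map _ _ _ _

lemma boundaryToMatching_eval {V : D} {A : SimplicialObject D} {n : ℕ}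
    (g : (SSet.boundary.{v} n : SSet.{v}) ⟶ homSSet V A) {k : SimplexCategory} (θ : k ⟶ ⦋n⦌)
    (hθ : ¬ Epi θ) : boundaryToMatching g ≫ matchingEval A θ hθ = boundaryVal g θ hθ := by
  rw [matchingEval, boundaryToMatching, reassoc_of% @matchingLift_π, boundaryVal_map]
  exact boundaryVal_congr g (image.fac θ) _ _

/-- The map out of `∂Δ[n]` given by a map to the matching object. -/
noncomputable def matchingToBoundary {V : D} {A : SimplicialObject D} {n : ℕ}
    (d : V ⟶ matchingObj A n) : (SSet.boundary.{v} n : SSet.{v}) ⟶ homSSet V A where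
  app k := ↾(fun x => (d ≫ matchingEval A (SSet.stdSimplex.objEquiv x.1)
    (not_epi_of_mem_boundary _ x.2) : V ⟶ A.obj k))
  naturality k l α := by
    ext x
    refine Eq.trans ?_ (Category.assoc _ _ _).symm
    exact congrArg (fun f => d ≫ f) (matchingEval_map A (SSet.stdSimplex.objEquiv x.1)
      (not_epi_of_mem_boundary _ x.2) α.unop).symm

lemma boundaryVal_matchingToBoundary {V : D} {A : SimplicialObject D} {n : ℕ}
    (d : V ⟶ matchingObj A n) {k : SimplexCategory} (θ : k ⟶ ⦋n⦌) (hθ : ¬ Epi θ) :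
    boundaryVal (matchingToBoundary d) θ hθ = d ≫ matchingEval A θ hθ := rfl

lemma matchingObj_hom_ext_eval {X : SimplicialObject D} {n : ℕ} {V : D} {f g : V ⟶ matchingObj X n}
    (h : ∀ (k : SimplexCategory) (θ : k ⟶ ⦋n⦌) (hθ : ¬ Epi θ),
      f ≫ matchingEval X θ hθ = g ≫ matchingEval X θ hθ) : f = g :=
  matchingObj_hom_ext fun k μ hμ => by
    simpa only [matchingEval_of_mono X μ hμ] using h k μ (not_epi_of_properFace hμ)

/-- Maps from `∂Δ[n]` to `D(V, A_•)` are maps from `V` to the matching object. -/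
noncomputable def boundaryEquiv (V : D) (A : SimplicialObject D) (n : ℕ) :
    ((SSet.boundary.{v} n : SSet.{v}) ⟶ homSSet V A) ≃ (V ⟶ matchingObj A n) where
  toFun := boundaryToMatching
  invFun := matchingToBoundary
  left_inv g := boundary_hom_ext fun k θ hθ => by
    rw [boundaryVal_matchingToBoundary, boundaryToMatching_eval]
  right_inv d := matchingObj_hom_ext_eval fun k θ hθ => by
    rw [boundaryToMatching_eval, boundaryVal_matchingToBoundary]

lemma boundaryEquiv_eval {V : D} {A : SimplicialObject D} {n : ℕ}
    (g : (SSet.boundary.{v} n : SSet.{v}) ⟶ homSSet V A) {k : SimplexCategory} (θ : k ⟶ ⦋n⦌)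
    (hθ : ¬ Epi θ) : boundaryEquiv V A n g ≫ matchingEval A θ hθ = boundaryVal g θ hθ :=
  boundaryToMatching_eval g θ hθ

lemma boundaryEquiv_homMap {V : D} {A B : SimplicialObject D} (φ : A ⟶ B) {n : ℕ}
    (g : (SSet.boundary.{v} n : SSet.{v}) ⟶ homSSet V A) :
    boundaryEquiv V B n (g ≫ homMap V φ) = boundaryEquiv V A n g ≫ matchingObjMap φ n :=
  matchingObj_hom_ext_eval fun k θ hθ => by
    rw [Category.assoc, matchingObjMap_eval, ← Category.assoc, boundaryEquiv_eval,
      boundaryEquiv_eval]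
    rfl

lemma boundaryEquiv_homPre {U V : D} (i : U ⟶ V) {A : SimplicialObject D} {n : ℕ}
    (g : (SSet.boundary.{v} n : SSet.{v}) ⟶ homSSet V A) :
    boundaryEquiv U A n (g ≫ homPre i A) = i ≫ boundaryEquiv V A n g :=
  matchingObj_hom_ext_eval fun k θ hθ => by
    rw [Category.assoc, boundaryEquiv_eval, boundaryEquiv_eval]
    rfl

lemma boundaryEquiv_ι_comp {V : D} {A : SimplicialObject D} {n : ℕ} (g : Δ[n] ⟶ homSSet V A) :
    boundaryEquiv V A n ((SSet.boundary.{v} n).ι ≫ g) = simplexEquiv V A n g ≫ matchingMap A n :=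
  matchingObj_hom_ext_eval fun k θ hθ => by
    rw [Category.assoc, boundaryEquiv_eval, matchingMap_eval, boundaryVal_ι_comp]

/-- Unfolds the pullback, so that lifting problems can be transposed and combined componentwise. -/
lemma hasLiftingProperty_relMatchingMap_iff {U V : D} (i : U ⟶ V) {A B : SimplicialObject D}
    (φ : A ⟶ B) (n : ℕ) :
    HasLiftingProperty i (relMatchingMap φ n) ↔
      ∀ (a : U ⟶ A.obj (op ⦋n⦌)) (d : V ⟶ matchingObj A n) (b : V ⟶ B.obj (op ⦋n⦌)),
        i ≫ d = a ≫ matchingMap A n → i ≫ b = a ≫ φ.app _ →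
        d ≫ matchingObjMap φ n = b ≫ matchingMap B n →
        ∃ l : V ⟶ A.obj (op ⦋n⦌), i ≫ l = a ∧ l ≫ matchingMap A n = d ∧ l ≫ φ.app _ = b := by
  constructor
  · intro h a d b h₁ h₂ h₃
    have sq : CommSq a i (relMatchingMap φ n) (pullback.lift d b h₃) := ⟨by
      apply pullback.hom_ext
      · rw [Category.assoc, Category.assoc, relMatchingMap_fst, pullback.lift_fst, h₁]
      · rw [Category.assoc, Category.assoc, relMatchingMap_snd, pullback.lift_snd, h₂]⟩
    refine ⟨sq.lift, sq.fac_left, ?_, ?_⟩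
    · rw [← relMatchingMap_fst φ n, ← Category.assoc, sq.fac_right, pullback.lift_fst]
    · rw [← relMatchingMap_snd φ n, ← Category.assoc, sq.fac_right, pullback.lift_snd]
  · intro h
    refine ⟨fun {a g} sq => ?_⟩
    obtain ⟨l, h₁, h₂, h₃⟩ := h a (g ≫ pullback.fst _ _) (g ≫ pullback.snd _ _)
      (by rw [← Category.assoc, ← sq.w, Category.assoc, relMatchingMap_fst])
      (by rw [← Category.assoc, ← sq.w, Category.assoc, relMatchingMap_snd])
      (by simp [pullback.condition])
    exact ⟨⟨⟨l, h₁, by apply pullback.hom_ext <;> simp [h₂, h₃]⟩⟩⟩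

/-- Maps from Δ[n] and ∂Δ[n] into D(V, A_•) are maps from V into A_n and into the matching object,
so a square from the boundary inclusion to `pullbackHom i φ` transposes to one from `i` to the
relative matching map. -/
lemma hasLiftingProperty_pullbackHom {U V : D} (i : U ⟶ V) {A B : SimplicialObject D}
    (φ : A ⟶ B) (n : ℕ) (h : HasLiftingProperty i (relMatchingMap φ n)) :
    HasLiftingProperty (SSet.boundary.{v} n).ι (pullbackHom i φ) := by
  rw [hasLiftingProperty_relMatchingMap_iff] at h
  refine ⟨fun {f g} sq => ?_⟩
  have w₁ : (SSet.boundary.{v} n).ι ≫ g ≫ pullback.fst _ _ = f ≫ homPre i A := by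
    rw [← Category.assoc, ← sq.w, Category.assoc, pullbackHom_fst]
  have w₂ : (SSet.boundary.{v} n).ι ≫ g ≫ pullback.snd _ _ = f ≫ homMap V φ := by
    rw [← Category.assoc, ← sq.w, Category.assoc, pullbackHom_snd]
  obtain ⟨l, h₁, h₂, h₃⟩ := h (simplexEquiv U A n (g ≫ pullback.fst _ _)) (boundaryEquiv V A n f)
    (simplexEquiv V B n (g ≫ pullback.snd _ _))
    (by rw [← boundaryEquiv_homPre, ← w₁, boundaryEquiv_ι_comp])
    (by rw [← simplexEquiv_homPre, ← simplexEquiv_homMap, Category.assoc, Category.assoc,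
      pullback.condition])
    (by rw [← boundaryEquiv_homMap, ← w₂, boundaryEquiv_ι_comp])
  refine ⟨⟨⟨(simplexEquiv V A n).symm l, ?_, ?_⟩⟩⟩
  · apply (boundaryEquiv V A n).injective
    rw [boundaryEquiv_ι_comp, Equiv.apply_symm_apply, h₂]
  · apply pullback.hom_ext
    · apply (simplexEquiv _ _ n).injective
      rw [Category.assoc, pullbackHom_fst, simplexEquiv_homPre, Equiv.apply_symm_apply, h₁]
    · apply (simplexEquiv _ _ n).injective
      rw [Category.assoc, pullbackHom_snd, simplexEquiv_homMap, Equiv.apply_symm_apply, h₃]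

/-- The boundary is built from the empty set by attaching its nondegenerate simplices, all of
dimension less than n. -/
lemma hasLiftingProperty_bot_boundary {E F : SSet.{v}} (p : E ⟶ F) (n : ℕ)
    (h : ∀ m < n, HasLiftingProperty (SSet.boundary.{v} m).ι p) :
    HasLiftingProperty (SSet.Subcomplex.ι (⊥ : (SSet.boundary.{v} n : SSet.{v}).Subcomplex)) p := by
  let I : MorphismProperty SSet.{v} := .ofHoms (fun m : Fin n => (SSet.boundary.{v} m).ι)
  have hp : I.rlp p := by
    rintro _ _ _ ⟨m⟩
    exact h m m.2
  let c := SSet.relativeCellComplex (SSet.boundary.{v} n : SSet.{v})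
  have hc := c.transfiniteCompositionOfShape' (I := I) fun s => by
    have hs : s.j < n := by
      have := s.k.nonDegenerate
      by_contra! hlt
      have h₂ := SSet.nonDegenerate_eq_empty_of_hasDimensionLT
        (SSet.boundary.{v} n : SSet.{v}) n s.j hlt
      rw [h₂] at this
      exact this
    exact ⟨(⟨s.j, hs⟩ : Fin n)⟩
  exact MorphismProperty.transfiniteCompositionsOfShape_pushouts_coproducts_le_llp_rlp.{v} I ℕ _
    hc.mem p hp

/-- A lift of `i` against the map of matching objects transposes to a lift of ∅ → ∂Δ[n] against
`pullbackHom i φ`, which only involves relative matching maps in degrees below n. -/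
lemma hasLiftingProperty_matchingObjMap {U V : D} (i : U ⟶ V) {A B : SimplicialObject D}
    (φ : A ⟶ B) (n : ℕ) (h : ∀ m < n, HasLiftingProperty i (relMatchingMap φ m)) :
    HasLiftingProperty i (matchingObjMap φ n) := by
  have hl := hasLiftingProperty_bot_boundary (pullbackHom i φ) n
    fun m hm => hasLiftingProperty_pullbackHom i φ m (h m hm)
  refine ⟨fun {a b} sq => ?_⟩
  let g : (SSet.boundary.{v} n : SSet.{v}) ⟶ pullback (homMap U φ) (homPre i B) :=
    pullback.lift ((boundaryEquiv U A n).symm a) ((boundaryEquiv V B n).symm b) (by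
      apply (boundaryEquiv U B n).injective
      rw [boundaryEquiv_homMap, boundaryEquiv_homPre, Equiv.apply_symm_apply,
        Equiv.apply_symm_apply, sq.w])
  have sq' : CommSq (SSet.Subcomplex.isInitialBot.to _)
    (SSet.Subcomplex.ι (⊥ : (SSet.boundary.{v} n : SSet.{v}).Subcomplex)) (pullbackHom i φ) g :=
    ⟨SSet.Subcomplex.isInitialBot.hom_ext _ _⟩
  have h₁ : sq'.lift ≫ homPre i A = (boundaryEquiv U A n).symm a := by
    rw [← pullbackHom_fst i φ, ← Category.assoc, sq'.fac_right, pullback.lift_fst]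
  have h₂ : sq'.lift ≫ homMap V φ = (boundaryEquiv V B n).symm b := by
    rw [← pullbackHom_snd i φ, ← Category.assoc, sq'.fac_right, pullback.lift_snd]
  refine ⟨⟨⟨boundaryEquiv V A n sq'.lift, ?_, ?_⟩⟩⟩
  · rw [← boundaryEquiv_homPre, h₁, Equiv.apply_symm_apply]
  · rw [← boundaryEquiv_homMap, h₂, Equiv.apply_symm_apply]

/-- For U initial the U-terms of the pullback are points, so `pullbackHom` is `homMap X φ` up to
isomorphism. -/
lemma hasLiftingProperty_homMap {U X : D} (hU : IsInitial U) {A B : SimplicialObject D}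
    (φ : A ⟶ B) (n : ℕ) (h : HasLiftingProperty (hU.to X) (relMatchingMap φ n)) :
    HasLiftingProperty (SSet.boundary.{v} n).ι (homMap X φ) := by
  have h₁ := hasLiftingProperty_pullbackHom _ φ n h
  have (k : SimplexCategoryᵒᵖ) : IsIso ((homMap U φ).app k) := by
    rw [isIso_iff_bijective]
    exact ⟨fun _ _ _ => hU.hom_ext _ _, fun _ => ⟨hU.to _, hU.hom_ext _ _⟩⟩
  have : IsIso (homMap U φ) := NatIso.isIso_of_isIso_app _
  rw [← pullbackHom_snd (hU.to X) φ]
  infer_instance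

end HomComplex

/-! ### Composites and products of Reedy fibrations -/

section ReedyFibrations

variable {D : Type u} [Category.{v} D] [HasFiniteLimits D]

/-- Lift through `ψ` and then through `φ`. Stating this for a class `L.rlp` replaces the pasting of
pullbacks by successive lifting. -/
lemma ReedyFibration.comp {L : MorphismProperty D} {A B C : SimplicialObject D} {φ : A ⟶ B}
    {ψ : B ⟶ C} (hφ : ReedyFibration L.rlp φ) (hψ : ReedyFibration L.rlp ψ) :
    ReedyFibration L.rlp (φ ≫ ψ) := fun n U V i hi => by
  rw [hasLiftingProperty_relMatchingMap_iff]
  intro a d c h₁ h₂ h₃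
  obtain ⟨b, hb₁, hb₂, hb₃⟩ := (hasLiftingProperty_relMatchingMap_iff i ψ n).1 (hψ n i hi)
    (a ≫ φ.app _) (d ≫ matchingObjMap φ n) c
    (by rw [Category.assoc, reassoc_of% h₁, matchingMap_naturality])
    (by rw [h₂, Category.assoc]; rfl)
    (by rw [Category.assoc, ← matchingObjMap_comp, h₃])
  obtain ⟨l, hl₁, hl₂, hl₃⟩ := (hasLiftingProperty_relMatchingMap_iff i φ n).1 (hφ n i hi) a d b
    h₁ hb₁ hb₂.symm
  exact ⟨l, hl₁, hl₂, by rw [NatTrans.comp_app, ← Category.assoc, hl₃, hb₃]⟩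

/-- The projection to B is a base change of A → ∗, so its relative matching maps lift whatever the
matching maps of A lift: the A-component is a lift, the B-component is prescribed. -/
lemma ReedyFibration.of_product {L : MorphismProperty D} {P A B : SimplicialObject D} (p : P ⟶ A)
    (q : P ⟶ B) (hP : ∀ k, Nonempty (IsLimit (BinaryFan.mk (p.app k) (q.app k))))
    (hA : ∀ n, L.rlp (matchingMap A n)) : ReedyFibration L.rlp q := fun n U V i hi => by
  have ext {n : ℕ} {V : D} {f g : V ⟶ P.obj (op ⦋n⦌)} (h : f ≫ p.app _ = g ≫ p.app _)
      (h' : f ≫ q.app _ = g ≫ q.app _) : f = g := BinaryFan.IsLimit.hom_ext (hP _).some h h'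
  have mext {V : D} {f g : V ⟶ matchingObj P n}
      (h : f ≫ matchingObjMap p n = g ≫ matchingObjMap p n)
      (h' : f ≫ matchingObjMap q n = g ≫ matchingObjMap q n) : f = g := by
    refine matchingObj_hom_ext fun k μ hμ => ext ?_ ?_
    · rw [Category.assoc, Category.assoc, ← matchingObjMap_π, reassoc_of% h]
    · rw [Category.assoc, Category.assoc, ← matchingObjMap_π, reassoc_of% h']
  rw [hasLiftingProperty_relMatchingMap_iff]
  intro a d b h₁ h₂ h₃
  have := hA n i hi
  have sq : CommSq (a ≫ p.app _) i (matchingMap A n) (d ≫ matchingObjMap p n) :=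
    ⟨by rw [Category.assoc, reassoc_of% h₁, matchingMap_naturality]⟩
  let l : V ⟶ P.obj (op ⦋n⦌) := (hP _).some.lift (BinaryFan.mk sq.lift b)
  have hl₁ : l ≫ p.app _ = sq.lift := (hP _).some.fac _ ⟨WalkingPair.left⟩
  have hl₂ : l ≫ q.app _ = b := (hP _).some.fac _ ⟨WalkingPair.right⟩
  refine ⟨l, ext ?_ ?_, mext ?_ ?_, hl₂⟩
  · rw [Category.assoc, hl₁, sq.fac_left]
  · rw [Category.assoc, hl₂, h₂]
  · rw [Category.assoc, matchingMap_naturality, reassoc_of% hl₁, sq.fac_right]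
  · rw [Category.assoc, matchingMap_naturality, reassoc_of% hl₂, h₃]

lemma lift_matchingCone_iff (Fib : MorphismProperty D) [Fib.RespectsIso] (X : SimplicialObject D)
    (n : ℕ) {c : Cone (matchingDiagram X n)} (hc : IsLimit c) :
    Fib (hc.lift (matchingCone X n)) ↔ Fib (matchingMap X n) := by
  let e : c.pt ≅ matchingObj X n := hc.conePointUniqueUpToIso (limit.isLimit _)
  have h : matchingMap X n = hc.lift (matchingCone X n) ≫ e.hom :=
    limit.hom_ext fun j => (limit.lift_π _ _).trans ((hc.fac _ j).symm.trans ((congrArg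
      (fun f => hc.lift (matchingCone X n) ≫ f) (hc.conePointUniqueUpToIso_hom_comp
        (limit.isLimit _) j).symm).trans (Category.assoc _ _ _).symm))
  have := Fib.cancel_right_of_respectsIso (hc.lift (matchingCone X n)) e.hom
  rw [h]
  exact this.symm

lemma ModelClasses.reedyFibrant_iff (S : ModelClasses D) [S.Fib.RespectsIso]
    (X : SimplicialObject D) : S.ReedyFibrant X ↔ ∀ n, S.Fib (matchingMap X n) :=
  ⟨fun h n => by
    obtain ⟨c, hc, hfib⟩ := h n
    exact (lift_matchingCone_iff _ X n hc).1 hfib,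
  fun h n => ⟨_, limit.isLimit _, h n⟩⟩

end ReedyFibrations

/-! ### Ken Brown's argument for homotopy function complexes -/

section KenBrown

variable {N : Type u} [Category.{v} N] [ModelCategory N]

/-- By induction on degree the map of matching objects is a trivial fibration; so is its base change
to the relative matching object, and 2-out-of-3 handles the relative matching map. -/
lemma ReedyFibration.trivialFibrations {A B : SimplicialObject N} {φ : A ⟶ B}
    (hφ : ReedyFibration (fibrations N) φ) (hW : ∀ k, weakEquivalences N (φ.app k)) :
    ReedyFibration (trivialFibrations N) φ := fun n => by
  induction n using Nat.strong_induction_on with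
  | _ n hn =>
    have h : HomotopicalAlgebra.trivialFibrations N (matchingObjMap φ n) := by
      rw [← cofibrations_rlp]
      intro U V i hi
      refine hasLiftingProperty_matchingObjMap i φ n fun m hm => ?_
      have := hn m hm
      rw [← cofibrations_rlp] at this
      exact this i hi
    refine ⟨hφ n, ?_⟩
    have h₂ : HomotopicalAlgebra.trivialFibrations N
        (pullback.snd (matchingObjMap φ n) (matchingMap B n)) :=
      MorphismProperty.pullback_snd _ _ h
    have h₃ : relMatchingMap φ n ≫ pullback.snd _ _ = φ.app _ := relMatchingMap_snd φ n
    exact (weakEquivalences N).of_postcomp _ _ h₂.2 (by rw [h₃]; exact hW _)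

lemma ReedyFibration.isSSetWeakEquivalence_homMap {A B : SimplicialObject N} {φ : A ⟶ B}
    (hφ : ReedyFibration (fibrations N) φ) (hW : ∀ k, weakEquivalences N (φ.app k)) (X : N)
    [hX : IsCofibrant X] : IsSSetWeakEquivalence (homMap X φ) :=
  isSSetWeakEquivalence_of_rlp _ fun n => hasLiftingProperty_homMap initialIsInitial φ n (by
    have h := hφ.trivialFibrations hW n
    rw [← cofibrations_rlp] at h
    refine h _ ?_
    have : Cofibration (initialIsInitial.to X) :=
      (isCofibrant_iff_of_isInitial _ initialIsInitial).1 hX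
    exact mem_cofibrations _)

/-- Levelwise weak equivalences of Reedy fibrant simplicial objects induce weak equivalences on
homotopy function complexes. -/
theorem isSSetWeakEquivalence_homMap {A B : SimplicialObject N} (φ : A ⟶ B)
    (hA : ∀ n, fibrations N (matchingMap A n)) (hB : ∀ n, fibrations N (matchingMap B n))
    (hW : ∀ k, weakEquivalences N (φ.app k)) (X : N) [IsCofibrant X] :
    IsSSetWeakEquivalence (homMap X φ) := by
  have hP (k) : IsLimit (BinaryFan.mk ((prod.fst : A ⨯ B ⟶ A).app k)
      ((prod.snd : A ⨯ B ⟶ B).app k)) :=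
    mapIsLimitOfPreservesOfIsLimit ((evaluation SimplexCategoryᵒᵖ N).obj k) _ _ (prodIsProd A B)
  rw [← trivialCofibrations_rlp] at hA hB
  have hq := ReedyFibration.of_product _ _ (fun k => ⟨hP k⟩) hA
  have hp := ReedyFibration.of_product _ _ (fun k => ⟨BinaryFan.isLimitFlip (hP k)⟩) hB
  -- Factor the graph of φ through a Reedy fibration to A × B. Both projections of E become
  -- levelwise trivial Reedy fibrations, `ι` is a section of the first, and its composite with the
  -- second is φ.
  obtain ⟨E, ι, π, fac, hι, hπ⟩ := exists_reedy_factorization (fibrations N) ⊤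
    (fun f _ => by
      let h := MorphismProperty.factorizationData (trivialCofibrations N) (fibrations N) f
      exact ⟨h.Z, h.i, h.p, by rw [fibrations_llp]; exact h.hi, h.hp, h.fac⟩)
    (fun _ _ _ => trivial) (prod.lift (𝟙 A) φ) (fun _ => trivial)
  rw [fibrations_llp] at hι
  have h₁ : ι ≫ π ≫ prod.fst = 𝟙 A := by rw [← Category.assoc, fac, prod.lift_fst]
  have h₂ : ι ≫ π ≫ prod.snd = φ := by rw [← Category.assoc, fac, prod.lift_snd]
  rw [← trivialCofibrations_rlp] at hπ
  have hπp := hπ.comp hp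
  have hπq := hπ.comp hq
  rw [trivialCofibrations_rlp] at hπp hπq
  have w₁ := hπp.isSSetWeakEquivalence_homMap (fun k => by
    refine (weakEquivalences N).of_precomp _ _ (hι k).2 ?_
    rw [← NatTrans.comp_app, h₁]
    exact (weakEquivalences N).id_mem _) X
  have w₂ := hπq.isSSetWeakEquivalence_homMap (fun k => by
    refine (weakEquivalences N).of_precomp _ _ (hι k).2 ?_
    rw [← NatTrans.comp_app, h₂]
    exact hW k) X
  rw [← h₂, homMap_comp]
  refine IsSSetWeakEquivalence.comp (IsSSetWeakEquivalence.of_section w₁ ?_) w₂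
  rw [← homMap_comp, h₁, homMap_id]

end KenBrown

/-! ### Cofibrancy detected by homotopy function complexes -/

section Cofibrant

variable {M : Type u} [Category.{v} M] [ModelCategory M]

lemma isTerminal_matchingObj_zero {D : Type u} [Category.{v} D] [HasFiniteLimits D]
    (X : SimplicialObject D) : Nonempty (IsTerminal (matchingObj X 0)) := by
  have h {k : SimplexCategory} {μ : k ⟶ ⦋0⦌} (hμ : Mono μ ∧ ¬ IsIso μ) : False := by
    simpa using len_lt_of_properFace hμ
  exact ⟨IsTerminal.ofUniqueHom (fun _ => matchingLift (fun k μ hμ => (h hμ).elim)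
    fun _ _ _ _ hμ => (h hμ).elim) fun _ _ => matchingObj_hom_ext fun k μ hμ => (h hμ).elim⟩

lemma isFibrant_obj_zero {X : SimplicialObject M} (hX : ∀ n, fibrations M (matchingMap X n)) :
    IsFibrant (X.obj (op ⦋0⦌)) := by
  obtain ⟨ht⟩ := isTerminal_matchingObj_zero X
  rw [isFibrant_iff_of_isTerminal (matchingMap X 0) ht]
  exact ⟨hX 0⟩

lemma weakEquivalences_map_of_isSimplicialResolution {A : M} {X : SimplicialObject M}
    {j : (SimplicialObject.const M).obj A ⟶ X}
    (hj : ∀ n, weakEquivalences M (j.app n)) {k l : SimplexCategoryᵒᵖ} (α : k ⟶ l) :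
    weakEquivalences M (X.map α) := by
  refine (weakEquivalences M).of_precomp (j.app k) _ (hj k) ?_
  rw [← j.naturality]
  exact (weakEquivalences M).comp_mem _ _ ((weakEquivalences M).id_mem _) (hj l)

/-- An edge of M(X, B_•) is a right homotopy with path object B_1: both faces B_1 → B_0 are inverted
to the same map, as retractions of one degeneracy. -/
lemma map_eq_of_π₀_eq {H : Type*} [Category* H] (L : M ⥤ H)
    [L.IsLocalization (weakEquivalences M)] {X : M} {B : SimplicialObject M}
    (hB : ∀ {k l : SimplexCategoryᵒᵖ} (α : k ⟶ l), weakEquivalences M (B.map α))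
    {g g' : X ⟶ B.obj (op ⦋0⦌)}
    (h : SSet.π₀.mk (X := homSSet X B) g = SSet.π₀.mk (X := homSSet X B) g') :
    L.map g = L.map g' := by
  refine congrArg (SSet.π₀.lift (X := homSSet X B)
    (fun g : X ⟶ B.obj (op ⦋0⦌) => L.map g) fun x y e => ?_) h
  have h₀ : (e.edge : X ⟶ B.obj (op ⦋1⦌)) ≫ B.δ 1 = x := e.src_eq
  have h₁ : (e.edge : X ⟶ B.obj (op ⦋1⦌)) ≫ B.δ 0 = y := e.tgt_eq
  have := Localization.inverts L (weakEquivalences M) _ (hB (SimplexCategory.σ (0 : Fin 1)).op)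
  have h₂ : L.map (B.δ (1 : Fin 2)) = L.map (B.δ (0 : Fin 2)) := by
    rw [← cancel_epi (L.map (B.map (SimplexCategory.σ (0 : Fin 1)).op)), ← L.map_comp,
      ← L.map_comp]
    congr 1
    exact (B.δ_comp_σ_succ (i := 0)).trans (B.δ_comp_σ_self (i := 0)).symm
  have h₃ (k : X ⟶ B.obj (op ⦋1⦌)) : L.map (k ≫ B.δ 1) = L.map (k ≫ B.δ 0) := by
    rw [L.map_comp, L.map_comp, h₂]
  exact (congrArg L.map h₀).symm.trans ((h₃ e.edge).trans (congrArg L.map h₁))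

/-- Surjectivity on π₀ gives a lift in the homotopy category. Since X is cofibrant and A, B are
fibrant, it is represented by a map lifting `g` up to homotopy, which covering homotopy along the
fibration `f` makes strict. -/
lemma exists_lift_of_resolution {X A B : M} [IsCofibrant X] [IsFibrant A] [IsFibrant B]
    {f : A ⟶ B} [Fibration f] (r : (ModelClasses.ofModelCategory M).MapResolution f)
    (hr : IsSSetWeakEquivalence (homMap X r.φ)) (g : X ⟶ B) : ∃ s : X ⟶ A, s ≫ f = g := by
  let L := (weakEquivalences M).Q
  have inv {U V : M} (w : U ⟶ V) (hw : weakEquivalences M w) : IsIso (L.map w) :=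
    Localization.inverts L (weakEquivalences M) w hw
  have : (ModelClasses.ofModelCategory M).Fib.RespectsIso :=
    inferInstanceAs (fibrations M).RespectsIso
  have hA := ((ModelClasses.ofModelCategory M).reedyFibrant_iff _).1 r.isRes_A.reedyFibrant
  have hB := ((ModelClasses.ofModelCategory M).reedyFibrant_iff _).1 r.isRes_B.reedyFibrant
  have := isFibrant_obj_zero hA
  have := isFibrant_obj_zero hB
  have := inv _ r.weq_a
  have := inv _ r.weq_b
  have := inv _ (r.isRes_A.weq (op ⦋0⦌))
  have := inv _ (r.isRes_B.weq (op ⦋0⦌))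
  obtain ⟨g₀, hg₀⟩ := map_surjective_of_isLocalization L X (r.resB.obj (op ⦋0⦌))
    (L.map g ≫ CategoryTheory.inv (L.map r.b) ≫ L.map (r.jB.app (op ⦋0⦌)))
  obtain ⟨z, hz⟩ := hr.mapπ₀_surjective (SSet.π₀.mk (X := homSSet X r.resB) g₀)
  obtain ⟨a₀, rfl⟩ := SSet.π₀.mk_surjective z
  change X ⟶ r.resA.obj (op ⦋0⦌) at a₀
  have h₀ : L.map (a₀ ≫ r.φ.app _) = L.map g₀ :=
    map_eq_of_π₀_eq L (weakEquivalences_map_of_isSimplicialResolution r.isRes_B.weq) hz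
  obtain ⟨s, hs⟩ := map_surjective_of_isLocalization L X A
    (L.map a₀ ≫ CategoryTheory.inv (L.map (r.jA.app (op ⦋0⦌))) ≫ L.map r.a)
  have hres : r.jA.app (op ⦋0⦌) ≫ r.φ.app (op ⦋0⦌) = r.f' ≫ r.jB.app (op ⦋0⦌) :=
    NatTrans.congr_app r.comm_res (op ⦋0⦌)
  have hres' : CategoryTheory.inv (L.map (r.jA.app (op ⦋0⦌))) ≫ L.map r.f' =
      L.map (r.φ.app (op ⦋0⦌)) ≫ CategoryTheory.inv (L.map (r.jB.app (op ⦋0⦌))) := by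
    rw [IsIso.inv_comp_eq, ← Category.assoc, IsIso.eq_comp_inv, ← L.map_comp, ← L.map_comp, hres]
  have key : L.map (s ≫ f) = L.map g := by
    rw [L.map_comp, hs, Category.assoc, Category.assoc, ← L.map_comp, r.comm, L.map_comp,
      reassoc_of% hres', ← Category.assoc, ← L.map_comp, h₀, hg₀]
    simp
  rw [← LeftHomotopyRel.iff_map_eq L X B] at key
  obtain ⟨P, _, ⟨h⟩⟩ := key.exists_good_cylinder
  obtain ⟨l, h', e⟩ := h.covering_homotopy f s
  exact ⟨l, by rw [← h'.h₁, Category.assoc, e, h.h₁]⟩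

/-- An object whose homotopy function complexes detect a class `W'` of maps is cofibrant with
respect to the fibrations in `W'`. -/
theorem llp_initial_of_resolutions (W' : MorphismProperty M) [W'.HasTwoOutOfThreeProperty]
    (hW' : weakEquivalences M ≤ W') [(fibrations M ⊓ W').IsStableUnderBaseChange]
    {I : M} (hI : IsInitial I) (X : M) [IsCofibrant X]
    (hfac : ∃ (X' : M) (q : X' ⟶ X), (fibrations M ⊓ W') q ∧ (fibrations M ⊓ W').llp (hI.to X'))
    (hres : ∀ {A B : M} (f : A ⟶ B), W' f →
      ∃ r : (ModelClasses.ofModelCategory M).MapResolution f,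
        IsSSetWeakEquivalence (homMap X r.φ)) :
    (fibrations M ⊓ W').llp (hI.to X) := by
  obtain ⟨X', q, hq, hX'⟩ := hfac
  have : Fibration q := ⟨hq.1⟩
  -- Fibrant replacement turns `q` into a fibration `d.p` between fibrant objects that is still in
  -- W'.
  let dX := MorphismProperty.factorizationData (trivialCofibrations M) (fibrations M)
    (terminal.from X)
  let d := MorphismProperty.factorizationData (trivialCofibrations M) (fibrations M) (q ≫ dX.i)
  have : IsFibrant dX.Z := (isFibrant_iff_of_isTerminal dX.p terminalIsTerminal).2 inferInstance
  have : IsFibrant d.Z := isFibrant_of_fibration d.p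
  have hqW : W' d.p := by
    refine W'.of_precomp d.i _ (hW' _ d.hi.2) ?_
    rw [d.fac]
    exact W'.comp_mem _ _ hq.2 (hW' _ dX.hi.2)
  obtain ⟨r, hr⟩ := hres d.p hqW
  obtain ⟨s, hs⟩ := exists_lift_of_resolution r hr dX.i
  -- The lift extends along the trivial cofibration `dX.i` to a section of `d.p`.
  have sq : CommSq s dX.i d.p (𝟙 _) := ⟨by rw [hs, Category.comp_id]⟩
  -- A path object over the base for `d.p`, whose endpoint map lies in W'. Hence X' lifts against it
  -- and yields a homotopy from `d.i` to `d.i ≫ d.p ≫ sq.lift`.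
  let e := MorphismProperty.factorizationData (trivialCofibrations M) (fibrations M)
    (pullback.diagonal d.p)
  have he : (fibrations M ⊓ W') e.p := by
    refine ⟨e.hp, ?_⟩
    have h : (fibrations M ⊓ W') (pullback.fst d.p d.p) :=
      MorphismProperty.pullback_fst _ _ ⟨d.hp, hqW⟩
    refine W'.of_precomp e.i _ (hW' _ e.hi.2) ?_
    refine W'.of_postcomp _ (pullback.fst d.p d.p) h.2 ?_
    rw [e.fac, pullback.diagonal_fst]
    exact hW' _ ((weakEquivalences M).id_mem _)
  have := hX' e.p he
  have sq' : CommSq (hI.to e.Z) (hI.to X') e.p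
    (pullback.lift d.i (d.i ≫ d.p ≫ sq.lift) (by
      rw [Category.assoc, Category.assoc, sq.fac_right, Category.comp_id])) := ⟨hI.hom_ext _ _⟩
  have h₁ : WeakEquivalence (e.p ≫ pullback.fst d.p d.p) :=
    weakEquivalence_of_precomp_of_fac (f := e.i) (fg := 𝟙 _)
      (by rw [← Category.assoc, e.fac, pullback.diagonal_fst])
  have h₂ : WeakEquivalence (e.p ≫ pullback.snd d.p d.p) :=
    weakEquivalence_of_precomp_of_fac (f := e.i) (fg := 𝟙 _)
      (by rw [← Category.assoc, e.fac, pullback.diagonal_snd])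
  have fac : sq'.lift ≫ e.p ≫ pullback.fst d.p d.p = d.i := by
    rw [← Category.assoc sq'.lift, sq'.fac_right, pullback.lift_fst]
  have h₃ : WeakEquivalence sq'.lift := weakEquivalence_of_postcomp_of_fac fac
  have h₄ : d.i ≫ d.p ≫ sq.lift = sq'.lift ≫ e.p ≫ pullback.snd d.p d.p := by
    rw [← Category.assoc sq'.lift, sq'.fac_right, pullback.lift_snd]
  have h₅ : WeakEquivalence (d.p ≫ sq.lift) :=
    weakEquivalence_of_precomp_of_fac (f := d.i) h₄
  -- As `sq.lift` is a section, `d.p` is a retract of the weak equivalence `d.p ≫ sq.lift`.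
  have h₆ : WeakEquivalence d.p := by
    rw [weakEquivalence_iff] at h₅ ⊢
    refine MorphismProperty.of_retract (h := ?_) h₅
    exact
      { i := Arrow.homMk (𝟙 _) sq.lift
        r := Arrow.homMk (𝟙 _) d.p (by simp [sq.fac_right])
        retract := by ext <;> simp [sq.fac_right] }
  have h₇ : WeakEquivalence q :=
    weakEquivalence_of_postcomp_of_fac (g := dX.i) d.fac.symm
  -- Now `q` is a trivial fibration and X is cofibrant, so X is a retract of X' and inherits its
  -- lifting property.
  have sq'' : CommSq (initial.to X') (initial.to X) q (𝟙 X) := ⟨by simp⟩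
  intro E F p hp
  have := hX' p hp
  refine ⟨fun {a b} sq₀ => ?_⟩
  have sq₁ : CommSq a (hI.to X') p (q ≫ b) := ⟨hI.hom_ext _ _⟩
  exact ⟨⟨⟨sq''.lift ≫ sq₁.lift, hI.hom_ext _ _, by
    rw [Category.assoc, sq₁.fac_right, ← Category.assoc, sq''.fac_right, Category.id_comp]⟩⟩⟩

end Cofibrant

/-! ### Existence of simplicial resolutions in model and semi-model categories -/

section Resolutions

variable {D : Type u} [Category.{v} D]

lemma isIso_matchingMap_const_terminal [HasFiniteLimits D] (n : ℕ) :
    IsIso (matchingMap ((SimplicialObject.const D).obj (⊤_ D)) n) := by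
  have h : IsTerminal (matchingObj ((SimplicialObject.const D).obj (⊤_ D)) n) :=
    IsTerminal.ofUniqueHom (fun V => matchingLift (fun _ _ _ => terminal.from V)
      fun _ _ _ _ _ _ => terminalIsTerminal.hom_ext _ _)
      fun _ _ => matchingObj_hom_ext fun _ _ _ => terminalIsTerminal.hom_ext _ _
  exact ⟨terminal.from _, terminalIsTerminal.hom_ext _ _, h.hom_ext _ _⟩

/-- The matching map of X is the relative one followed by a base change of the matching map of Y. -/
lemma ReedyFibration.fib_matchingMap [HasFiniteLimits D] (Fib : MorphismProperty D)
    [Fib.IsMultiplicative] [Fib.IsStableUnderBaseChange] {X Y : SimplicialObject D} {φ : X ⟶ Y}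
    (hφ : ReedyFibration Fib φ) (hY : ∀ n, Fib (matchingMap Y n)) (n : ℕ) :
    Fib (matchingMap X n) := by
  have h := Fib.comp_mem _ _ (hφ n)
    (MorphismProperty.pullback_fst (matchingObjMap φ n) (matchingMap Y n) (hY n))
  rwa [relMatchingMap_fst] at h

namespace ModelClasses

variable (S : ModelClasses D)

/-- Existence of simplicial resolutions, for maps which are weakly equivalent to a map between
objects for which suitable factorizations exist. -/
lemma nonempty_mapResolution [HasFiniteLimits D] [HasFiniteColimits D] [S.Fib.IsMultiplicative]
    [S.Fib.IsStableUnderBaseChange] (good : ObjectProperty D)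
    (hfac : ∀ {X Y : D} (f : X ⟶ Y), good X →
      ∃ (Z : D) (i : X ⟶ Z) (p : Z ⟶ Y), S.Fib.llp i ∧ S.Fib p ∧ i ≫ p = f)
    (hgood : ∀ {X Y : D} (i : X ⟶ Y), good X → S.Fib.llp i → good Y)
    (hW : ∀ {X Y : D} (i : X ⟶ Y), good X → S.Fib.llp i → S.W i)
    {A B A' B' : D} (f : A ⟶ B) (a : A' ⟶ A) (b : B' ⟶ B) (f' : A' ⟶ B') (ha : S.W a)
    (hb : S.W b) (comm : a ≫ f = f' ≫ b) (hA' : good A') (hB' : good B') :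
    Nonempty (S.MapResolution f) := by
  obtain ⟨resB, jB, πB, -, hjB, hπB⟩ := exists_reedy_factorization S.Fib good hfac hgood
    ((SimplicialObject.const D).map (terminal.from B')) fun _ => hB'
  have hresB := hπB.fib_matchingMap _ fun n => by
    have := isIso_matchingMap_const_terminal (D := D) n
    exact S.Fib.of_isIso _
  -- Factoring over the resolution of B' makes `φ` a Reedy fibration, so that Reedy fibrancy of the
  -- source follows from that of the target.
  obtain ⟨resA, jA, φ, fac, hjA, hφ⟩ := exists_reedy_factorization S.Fib good hfac hgood
    ((SimplicialObject.const D).map f' ≫ jB) fun _ => hA'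
  have hresA := hφ.fib_matchingMap _ hresB
  exact ⟨
    { A' := A'
      B' := B'
      a := a
      b := b
      weq_a := ha
      weq_b := hb
      f' := f'
      comm := comm
      resA := resA
      resB := resB
      jA := jA
      jB := jB
      isRes_A := ⟨(S.reedyFibrant_iff _).2 hresA, fun k => hW _ hA' (hjA k)⟩
      isRes_B := ⟨(S.reedyFibrant_iff _).2 hresB, fun k => hW _ hB' (hjB k)⟩
      φ := φ
      comm_res := fac }⟩

variable {S}

namespace IsModel

lemma twoOutOfThree (hS : S.IsModel) : S.W.HasTwoOutOfThreeProperty := by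
  obtain ⟨_, rfl⟩ := hS
  exact inferInstanceAs (weakEquivalences D).HasTwoOutOfThreeProperty

lemma id_mem (hS : S.IsModel) (X : D) : S.W (𝟙 X) := by
  obtain ⟨_, rfl⟩ := hS
  exact (weakEquivalences D).id_mem X

lemma isStableUnderBaseChange_trivFib (hS : S.IsModel) : S.TrivFib.IsStableUnderBaseChange := by
  obtain ⟨_, rfl⟩ := hS
  exact inferInstanceAs (trivialFibrations D).IsStableUnderBaseChange

lemma cof_eq (hS : S.IsModel) : S.Cof = S.TrivFib.llp := by
  obtain ⟨_, rfl⟩ := hS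
  exact (trivialFibrations_llp D).symm

lemma exists_factorization (hS : S.IsModel) {X Y : D} (f : X ⟶ Y) :
    ∃ (Z : D) (i : X ⟶ Z) (p : Z ⟶ Y), S.Cof i ∧ S.TrivFib p ∧ i ≫ p = f := by
  obtain ⟨_, rfl⟩ := hS
  let h := MorphismProperty.factorizationData (cofibrations D) (trivialFibrations D) f
  exact ⟨h.Z, h.i, h.p, h.hi, h.hp, h.fac⟩

lemma isSSetWeakEquivalence_homMap (hS : S.IsModel) {A B : SimplicialObject D} (φ : A ⟶ B)
    (hA : S.ReedyFibrant A) (hB : S.ReedyFibrant B) (hW : ∀ k, S.W (φ.app k)) {X : D}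
    (hX : S.Cofibrant X) : IsSSetWeakEquivalence (homMap X φ) := by
  obtain ⟨_, rfl⟩ := hS
  have : (ofModelCategory D).Fib.RespectsIso := inferInstanceAs (fibrations D).RespectsIso
  obtain ⟨I, hI, h⟩ := hX
  have : IsCofibrant X := (isCofibrant_iff_of_isInitial _ hI).2 ⟨h⟩
  exact RightLoc.isSSetWeakEquivalence_homMap φ ((reedyFibrant_iff _ _).1 hA)
    ((reedyFibrant_iff _ _).1 hB) hW X

lemma nonempty_mapResolution (hS : S.IsModel) {A B : D} (f : A ⟶ B) :
    Nonempty (S.MapResolution f) := by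
  obtain ⟨_, rfl⟩ := hS
  have : (ofModelCategory D).Fib.IsMultiplicative := inferInstanceAs (fibrations D).IsMultiplicative
  have : (ofModelCategory D).Fib.IsStableUnderBaseChange :=
    inferInstanceAs (fibrations D).IsStableUnderBaseChange
  have hllp : (ofModelCategory D).Fib.llp = trivialCofibrations D := fibrations_llp D
  refine ModelClasses.nonempty_mapResolution _ ⊤ (fun f _ => ?_) (fun _ _ _ => trivial)
    (fun i _ hi => ?_) f (𝟙 _) (𝟙 _) f ((weakEquivalences D).id_mem _)
    ((weakEquivalences D).id_mem _) (by simp) trivial trivial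
  · let h := MorphismProperty.factorizationData (trivialCofibrations D) (fibrations D) f
    exact ⟨h.Z, h.i, h.p, by rw [hllp]; exact h.hi, h.hp, h.fac⟩
  · rw [hllp] at hi
    exact hi.2

end IsModel

namespace SemiModelAxioms

variable {dom : ObjectProperty D}

lemma exists_factorization (hS : S.SemiModelAxioms dom) {X Y : D} (f : X ⟶ Y) :
    ∃ (Z : D) (i : X ⟶ Z) (p : Z ⟶ Y), S.Cof i ∧ S.TrivFib p ∧ i ≫ p = f := by
  have := hS.factor_cof_trivFib
  let h := MorphismProperty.factorizationData S.Cof S.TrivFib f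
  exact ⟨h.Z, h.i, h.p, h.hi, h.hp, h.fac⟩

lemma exists_factorization_of_dom (hS : S.SemiModelAxioms dom) {X Y : D} (f : X ⟶ Y)
    (hX : dom X) :
    ∃ (Z : D) (i : X ⟶ Z) (p : Z ⟶ Y), S.TrivCof i ∧ S.Fib p ∧ i ≫ p = f := by
  obtain ⟨h⟩ := hS.factor_trivCof_fib
  exact ⟨_, h.i.app ⟨Arrow.mk f, hX⟩, h.p.app ⟨Arrow.mk f, hX⟩, h.hi _, h.hp _, h.fac _⟩

/-- The retract argument. It uses only the factorization that carries no condition on domains. -/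
lemma cof_eq (hS : S.SemiModelAxioms dom) : S.Cof = S.TrivFib.llp := by
  have := hS.retract_Cof
  refine le_antisymm (fun _ _ i hi _ _ p hp => hS.lift_cof_trivFib i p hi hp) fun X Y f hf => ?_
  obtain ⟨Z, i, p, hi, hp, fac⟩ := hS.exists_factorization f
  have := hf p hp
  exact S.Cof.of_retract (RetractArrow.ofLeftLiftingProperty fac) hi

lemma trivCof_of_llp (hS : S.SemiModelAxioms dom) {X Y : D} (f : X ⟶ Y) (hX : dom X)
    (hf : S.Fib.llp f) : S.TrivCof f := by
  have := hS.retract_Cof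
  have := hS.retract_W
  obtain ⟨Z, i, p, hi, hp, fac⟩ := hS.exists_factorization_of_dom f hX
  have := hf p hp
  have h := RetractArrow.ofLeftLiftingProperty fac
  exact ⟨S.Cof.of_retract h hi.1, S.W.of_retract h hi.2⟩

end SemiModelAxioms

/-- Replace `f` by a map between cofibrant approximations; trivial cofibrations out of cofibrant
objects stay among cofibrant objects, so all factorizations needed are available. -/
lemma IsSemiModel.nonempty_mapResolution (hS : S.IsSemiModel) [S.Fib.IsMultiplicative] {A B : D}
    (f : A ⟶ B) : Nonempty (S.MapResolution f) := by
  have := hS.hasLimits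
  have := hS.hasColimits
  have := hS.pullback_fib
  obtain ⟨A', iA, a, hA', ha, -⟩ := hS.exists_factorization (initial.to A)
  obtain ⟨B', iB, b, hB', hb, -⟩ := hS.exists_factorization (initial.to B)
  have cofibrant {X : D} (i : ⊥_ D ⟶ X) (hi : S.Cof i) : S.Cofibrant X :=
    ⟨_, initialIsInitial, by rwa [initialIsInitial.hom_ext (initialIsInitial.to X) i]⟩
  have := hS.lift_cof_trivFib iA b hA' hb
  have sq : CommSq (initial.to B') iA b (a ≫ f) := ⟨initialIsInitial.hom_ext _ _⟩
  refine ModelClasses.nonempty_mapResolution S S.Cofibrant (fun f hX => ?_) (fun i hX hi => ?_)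
    (fun i hX hi => (hS.trivCof_of_llp i hX hi).2) f a b sq.lift ha.2 hb.2 sq.fac_right.symm
    (cofibrant _ hA') (cofibrant _ hB')
  · obtain ⟨Z, i, p, hi, hp, fac⟩ := hS.exists_factorization_of_dom f hX
    exact ⟨Z, i, p, fun _ _ q hq => hS.lift_trivCof_fib i q hX hi hq, hp, fac⟩
  · obtain ⟨I, hI, h⟩ := hX
    refine ⟨I, hI, ?_⟩
    rw [hI.hom_ext (hI.to _) (hI.to _ ≫ i)]
    rw [hS.cof_eq] at h ⊢
    exact MorphismProperty.comp_mem _ _ _ h fun _ _ q hq => hi q hq.1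

end ModelClasses

end Resolutions

/-! ### Resolutions and function complexes under the free-forgetful adjunction -/

section Transfer

variable {M : Type u} [Category.{v} M] {T : Monad M}

/-- The image of a simplicial object under the forgetful functor. -/
abbrev forgetSimplicial (X : SimplicialObject T.Algebra) : SimplicialObject M :=
  ((SimplicialObject.whiskering _ _).obj T.forget).obj X

/-- Restriction along the unit, as a map of homotopy function complexes. -/
def homFreeIso (X : M) (A : SimplicialObject T.Algebra) :
    homSSet (T.free.obj X) A ≅ homSSet X (forgetSimplicial A) :=
  NatIso.ofComponents (fun k => (T.adj.homEquiv X (A.obj k)).toIso) fun {k l} α => by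
    ext g
    exact T.adj.homEquiv_naturality_right g (A.map α)

lemma isSSetWeakEquivalence_homMap_free_iff (X : M) {A B : SimplicialObject T.Algebra}
    (φ : A ⟶ B) : IsSSetWeakEquivalence (homMap (T.free.obj X) φ) ↔
      IsSSetWeakEquivalence
        (homMap X (((SimplicialObject.whiskering _ _).obj T.forget).map φ)) := by
  have e : Arrow.mk (homMap (T.free.obj X) φ) ≅
      Arrow.mk (homMap X (((SimplicialObject.whiskering _ _).obj T.forget).map φ)) :=
    Arrow.isoMk (homFreeIso X A) (homFreeIso X B) (by
      ext k g
      exact (T.adj.homEquiv_naturality_right g (φ.app k)).symm)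
  exact ⟨fun h => h.of_arrow_iso e, fun h => h.of_arrow_iso e.symm⟩

namespace IsTransferred

variable {N : ModelClasses M} {S : ModelClasses T.Algebra}

/-- The forgetful functor preserves limits, in particular matching objects. -/
lemma reedyFibrant (h : IsTransferred N S) {X : SimplicialObject T.Algebra}
    (hX : S.ReedyFibrant X) : N.ReedyFibrant (forgetSimplicial X) := fun n => by
  obtain ⟨c, hc, hfib⟩ := hX n
  let c' : Cone (matchingDiagram (forgetSimplicial X) n) := T.forget.mapCone c
  let hc' : IsLimit c' := isLimitOfPreserves T.forget hc
  refine ⟨c', hc', ?_⟩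
  have e : hc'.lift (matchingCone (forgetSimplicial X) n) =
      T.forget.map (hc.lift (matchingCone X n)) :=
    (hc'.uniq (matchingCone (forgetSimplicial X) n) _ fun j =>
      (T.forget.map_comp _ _).symm.trans (congrArg T.forget.map (hc.fac _ j))).symm
  rw [e]
  exact (h.fib_iff _).1 hfib

/-- The image of a coaugmentation under the forgetful functor. -/
def forgetCoaugmentation {A : T.Algebra} {X : SimplicialObject T.Algebra}
    (j : (SimplicialObject.const T.Algebra).obj A ⟶ X) :
    (SimplicialObject.const M).obj (T.forget.obj A) ⟶ forgetSimplicial X where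
  app k := T.forget.map (j.app k)
  naturality k l α := by
    have := congrArg T.forget.map ((Category.id_comp _).symm.trans (j.naturality α))
    exact (Category.id_comp _).trans (this.trans (T.forget.map_comp _ _))

/-- The image of a resolution under the forgetful functor. -/
def mapResolution (h : IsTransferred N S) {A B : T.Algebra} {f : A ⟶ B}
    (r : S.MapResolution f) : N.MapResolution (T.forget.map f) where
  A' := T.forget.obj r.A'
  B' := T.forget.obj r.B'
  a := T.forget.map r.a
  b := T.forget.map r.b
  weq_a := (h.weq_iff _).1 r.weq_a
  weq_b := (h.weq_iff _).1 r.weq_b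
  f' := T.forget.map r.f'
  comm := by rw [← T.forget.map_comp, r.comm, T.forget.map_comp]
  resA := forgetSimplicial r.resA
  resB := forgetSimplicial r.resB
  jA := forgetCoaugmentation r.jA
  jB := forgetCoaugmentation r.jB
  isRes_A := ⟨h.reedyFibrant r.isRes_A.reedyFibrant, fun n => (h.weq_iff _).1 (r.isRes_A.weq n)⟩
  isRes_B := ⟨h.reedyFibrant r.isRes_B.reedyFibrant, fun n => (h.weq_iff _).1 (r.isRes_B.weq n)⟩
  φ := ((SimplicialObject.whiskering _ _).obj T.forget).map r.φ
  comm_res := by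
    ext k
    have := congrArg T.forget.map (NatTrans.congr_app r.comm_res k)
    exact (T.forget.map_comp _ _).symm.trans (this.trans (T.forget.map_comp _ _))

end IsTransferred

end Transfer

/-! ### Comparison of colocal equivalences and of the two structures -/

section Localization

variable {M : Type u} [Category.{v} M] [ModelCategory M] {K : Set M}

/-- A resolution of an identity map is also a resolution of each weak equivalence with the same
source; hence weak equivalences are colocal equivalences. -/
lemma weakEquivalences_le_colocalEquivalence
    (hRK : ((ModelClasses.ofModelCategory M).rightBousfield K).IsModel) :
    weakEquivalences M ≤ (ModelClasses.ofModelCategory M).ColocalEquivalence K :=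
  fun A B f hf X hX => by
    obtain ⟨r, -⟩ := hRK.id_mem A X hX
    refine ⟨
      { A' := r.A'
        B' := r.A'
        a := r.a
        b := r.a ≫ f
        weq_a := r.weq_a
        weq_b := (weakEquivalences M).comp_mem _ _ r.weq_a hf
        f' := 𝟙 _
        comm := (Category.id_comp _).symm
        resA := r.resA
        resB := r.resA
        jA := r.jA
        jB := r.jA
        isRes_A := r.isRes_A
        isRes_B := r.isRes_A
        φ := 𝟙 _
        comm_res := by simp }, ?_⟩
    rw [homMap_id]
    exact IsSSetWeakEquivalence.of_iso (Iso.refl _)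

/-- Factoring ∅ → X in R_K M gives a colocally trivial fibration onto X from an object cofibrant
there, as `llp_initial_of_resolutions` requires. -/
lemma cofibrant_rightBousfield
    (hRK : ((ModelClasses.ofModelCategory M).rightBousfield K).IsModel) {X : M} (hX : X ∈ K)
    [IsCofibrant X] : ((ModelClasses.ofModelCategory M).rightBousfield K).Cofibrant X := by
  have h₁ : ((ModelClasses.ofModelCategory M).ColocalEquivalence K).HasTwoOutOfThreeProperty :=
    hRK.twoOutOfThree
  have h₂ : (fibrations M ⊓
      (ModelClasses.ofModelCategory M).ColocalEquivalence K).IsStableUnderBaseChange :=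
    hRK.isStableUnderBaseChange_trivFib
  refine ⟨_, initialIsInitial, llp_initial_of_resolutions _
    (weakEquivalences_le_colocalEquivalence hRK) initialIsInitial X ?_ fun f hf => hf X hX⟩
  obtain ⟨X', i, q, hi, hq, -⟩ := hRK.exists_factorization (initial.to X)
  refine ⟨X', q, hq, ?_⟩
  rw [initialIsInitial.hom_ext (initialIsInitial.to X') i]
  exact hi

variable {T : Monad M} {S : ModelClasses T.Algebra}

/-- Colocal equivalences of algebras are created by the forgetful functor. -/
theorem colocalEquivalence_iff (hK : ∀ X ∈ K, IsCofibrant X)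
    (hRK : ((ModelClasses.ofModelCategory M).rightBousfield K).IsModel)
    (hS : IsTransferred (ModelClasses.ofModelCategory M) S)
    (hres : ∀ {A B : T.Algebra} (f : A ⟶ B), Nonempty (S.MapResolution f))
    {A B : T.Algebra} (f : A ⟶ B) :
    S.ColocalEquivalence (T.free.obj '' K) f ↔
      (ModelClasses.ofModelCategory M).ColocalEquivalence K (T.forget.map f) := by
  constructor
  · intro h X hX
    obtain ⟨r, hr⟩ := h _ ⟨X, hX, rfl⟩
    exact ⟨hS.mapResolution r, (isSSetWeakEquivalence_homMap_free_iff X r.φ).1 hr⟩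
  · rintro h _ ⟨X, hX, rfl⟩
    -- Any resolution of algebras will do; the ones provided by `h` are used only through `W
    -- (T.forget.map f)`.
    obtain ⟨r⟩ := hres f
    refine ⟨r, (isSSetWeakEquivalence_homMap_free_iff X r.φ).2 ?_⟩
    let W := (ModelClasses.ofModelCategory M).ColocalEquivalence K
    have : W.HasTwoOutOfThreeProperty := hRK.twoOutOfThree
    have hW : weakEquivalences M ≤ W := weakEquivalences_le_colocalEquivalence hRK
    have := hK X hX
    let r' := hS.mapResolution r
    have hf' : W r'.f' := by
      refine W.of_postcomp _ r'.b (hW _ r'.weq_b) ?_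
      rw [← r'.comm]
      exact W.comp_mem _ _ (hW _ r'.weq_a) h
    -- Ken Brown's argument is applied in R_K M and not in M: there levelwise colocal equivalences
    -- suffice, and Reedy fibrancy means the same.
    refine hRK.isSSetWeakEquivalence_homMap r'.φ r'.isRes_A.reedyFibrant r'.isRes_B.reedyFibrant
      (fun k => ?_) (cofibrant_rightBousfield hRK hX)
    refine W.of_precomp (r'.jA.app k) _ (hW _ (r'.isRes_A.weq k)) ?_
    rw [← NatTrans.comp_app, r'.comm_res]
    exact W.comp_mem _ _ hf' (hW _ (r'.isRes_B.weq k))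

/-- The comparison of transferred and localized structures, for a class of structures in which
the cofibrations are determined by the trivial fibrations. -/
theorem exists_transferred_iff (hK : ∀ X ∈ K, IsCofibrant X)
    (hRK : ((ModelClasses.ofModelCategory M).rightBousfield K).IsModel)
    (hS : IsTransferred (ModelClasses.ofModelCategory M) S)
    (hres : ∀ {A B : T.Algebra} (f : A ⟶ B), Nonempty (S.MapResolution f))
    (P : ModelClasses T.Algebra → Prop) (hP : ∀ S', P S' → S'.Cof = S'.TrivFib.llp) :
    ((∃ S' : ModelClasses T.Algebra,
        IsTransferred ((ModelClasses.ofModelCategory M).rightBousfield K) S' ∧ P S') ↔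
      P (S.rightBousfield (T.free.obj '' K))) ∧
    ∀ S' : ModelClasses T.Algebra,
      IsTransferred ((ModelClasses.ofModelCategory M).rightBousfield K) S' ∧ P S' →
        S' = S.rightBousfield (T.free.obj '' K) := by
  have key {A B : T.Algebra} (f : A ⟶ B) := colocalEquivalence_iff hK hRK hS hres f
  have huniq (S' : ModelClasses T.Algebra)
      (h : IsTransferred ((ModelClasses.ofModelCategory M).rightBousfield K) S' ∧ P S') :
      S' = S.rightBousfield (T.free.obj '' K) := by
    have hW : S'.W = S.ColocalEquivalence (T.free.obj '' K) := by
      ext A B f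
      exact (h.1.weq_iff f).trans (key f).symm
    have hFib : S'.Fib = S.Fib := by
      ext A B f
      exact (h.1.fib_iff f).trans (hS.fib_iff f).symm
    refine ModelClasses.ext hW hFib ?_
    rw [hP S' h.2, ModelClasses.TrivFib, hW, hFib]
    rfl
  refine ⟨⟨?_, fun h => ⟨S.rightBousfield _, ⟨fun f => key f, fun f => hS.fib_iff f⟩, h⟩⟩, huniq⟩
  rintro ⟨S', h⟩
  rw [← huniq S' h]
  exact h.2

/-- Closure of fibrations under composition is not among the semi-model axioms, so it is inherited
from M. -/
lemma IsTransferred.isMultiplicative_fib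
    (hS : IsTransferred (ModelClasses.ofModelCategory M) S) : S.Fib.IsMultiplicative := by
  have h : S.Fib = (fibrations M).inverseImage T.forget := by
    ext A B f
    exact hS.fib_iff f
  rw [h]
  infer_instance

end Localization

end RightLoc

open RightLoc in
theorem mainTheorem2 {M : Type u} [Category.{v} M] [ModelCategory M]
    (K : Set M) (hK : ∀ X ∈ K, IsCofibrant X)
    (hRK : ((ModelClasses.ofModelCategory M).rightBousfield K).IsModel)
    (T : Monad M) (S : ModelClasses T.Algebra) :
    -- model categories
    (IsAdmissibleStructure (ModelClasses.ofModelCategory M) S →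
      ((∃ S' : ModelClasses T.Algebra,
          IsAdmissibleStructure ((ModelClasses.ofModelCategory M).rightBousfield K) S') ↔
        (S.rightBousfield (T.free.obj '' K)).IsModel) ∧
      ∀ S' : ModelClasses T.Algebra,
        IsAdmissibleStructure ((ModelClasses.ofModelCategory M).rightBousfield K) S' →
          S' = S.rightBousfield (T.free.obj '' K)) ∧
    -- semi-model categories
    (IsSemiAdmissibleStructure (ModelClasses.ofModelCategory M) S →
      (((∃ S' : ModelClasses T.Algebra,
          IsSemiAdmissibleStructure ((ModelClasses.ofModelCategory M).rightBousfield K) S') ↔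
        (S.rightBousfield (T.free.obj '' K)).IsSemiModel) ∧
      ∀ S' : ModelClasses T.Algebra,
        IsSemiAdmissibleStructure ((ModelClasses.ofModelCategory M).rightBousfield K) S' →
          S' = S.rightBousfield (T.free.obj '' K)) ∧
      -- the same with cofibrancy of domains tested in the base
      ((∃ S' : ModelClasses T.Algebra,
          IsSemiAdmissibleOverStructure ((ModelClasses.ofModelCategory M).rightBousfield K) S') ↔
        (S.rightBousfield (T.free.obj '' K)).IsSemiModelOver
          ((ModelClasses.ofModelCategory M).rightBousfield K) T.forget) ∧
      ∀ S' : ModelClasses T.Algebra,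
        IsSemiAdmissibleOverStructure ((ModelClasses.ofModelCategory M).rightBousfield K) S' →
          S' = S.rightBousfield (T.free.obj '' K)) := by
  refine ⟨fun hS => ?_, fun hS => ⟨?_, ?_⟩⟩
  · exact exists_transferred_iff hK hRK hS.1 hS.2.nonempty_mapResolution _ fun _ h => h.cof_eq
  · have := hS.1.isMultiplicative_fib
    exact exists_transferred_iff hK hRK hS.1 hS.2.nonempty_mapResolution _ fun _ h => h.cof_eq
  · have := hS.1.isMultiplicative_fib
    exact exists_transferred_iff hK hRK hS.1 hS.2.nonempty_mapResolution _
      fun _ h => h.toSemiModelAxioms.cof_eq
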